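/- Let $n\ge 1$, let $\Omega\subset\mathbb{R}^n$ be a bounded domain with smooth boundary, and let $\gamma$ be its outer unit normal. Let $a_{ij}\in W^{1,\infty}(\Omega)$, $b_i,c\in L^\infty(\Omega)$, $\beta_i\in W^{1,\infty}(\partial\Omega)$ (that is, $\beta_i$ is Lipschitz on $\partial\Omega$) and $\ell\in L^\infty(\partial\Omega)$, $1\le i,j\le n$, be real valued. Assume that there are constants $\lambda,\chi>0$ with $$a_{ij}(x)\xi_i\xi_j\ge\lambda|\xi|^2\quad\text{for a.e. } x\in\Omega\text{ and all }\xi\in\mathbb{R}^n,\qquad \beta_i(x)\gamma_i(x)\ge\chi\quad\text{for all }x\in\partial\Omega$$ (repeated indices are summed from $1$ to $n$). Then there exists a real number $\mu_*$, depending only on $n$, $\Omega$, $\lambda$, $\chi$ and upper bounds for $\|a_{ij}\|_{W^{1,\infty}(\Omega)}$, $\|b_i\|_{L^\infty(\Omega)}$, $\|c^+\|_{L^\infty(\Omega)}$, $\|\beta_i\|_{W^{1,\infty}(\partial\Omega)}$ and $\|\ell^-\|_{L^\infty(\partial\Omega)}$, where $c^+=\max(c,0)$ and $\ell^-=\max(-\ell,0)$,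 such that for every real $\mu>\mu_*$ the problem $$a_{ij}u_{ij}+b_iu_i+cu=\mu u\quad\text{a.e. in }\Omega,\qquad \beta_iu_i+\ell u=0\quad\text{a.e. on }\partial\Omega,$$ where the boundary condition is understood in the sense of traces, has no nontrivial solution $u\in H^2(\Omega)$. -/

import Mathlib

open MeasureTheory Filter Topology Set
open scoped NNReal ENNReal ContDiff

noncomputable section

/-- In the ball of radius `r` about `x`, the set `Ω` is the region strictly below the graph of the
smooth function `h` over the hyperplane orthogonal to the unit vector `v`. The function `h` is
defined on the whole space and does not depend on the coordinate along `v`. -/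
structure IsLocalGraph {n : ℕ} (Ω : Set (EuclideanSpace ℝ (Fin n)))
    (x v : EuclideanSpace ℝ (Fin n)) (h : EuclideanSpace ℝ (Fin n) → ℝ) (r : ℝ) : Prop where
  radius_pos : 0 < r
  norm_eq_one : ‖v‖ = 1
  contDiff : ContDiff ℝ ∞ h
  invariant : ∀ (y : EuclideanSpace ℝ (Fin n)) (t : ℝ), h (y + t • v) = h y
  inter_ball : Ω ∩ Metric.ball x r = {y | y ∈ Metric.ball x r ∧ inner ℝ v y < h y}

/-- A bounded domain (nonempty connected open set) with smooth boundary: near each of its boundary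
points it lies on one side of the graph of a smooth function. -/
structure IsSmoothBoundedDomain {n : ℕ} (Ω : Set (EuclideanSpace ℝ (Fin n))) : Prop where
  isOpen : IsOpen Ω
  isConnected : IsConnected Ω
  isBounded : Bornology.IsBounded Ω
  smooth_boundary : ∀ x ∈ frontier Ω, ∃ v h r, IsLocalGraph Ω x v h r

/-- `ν` is the outer unit normal of `Ω` at the boundary point `x`. If `Ω` is `{⟪v, y⟫ < h y}`
near `x`, this is the normalized gradient of the defining function `y ↦ ⟪v, y⟫ - h y`. -/
def IsOuterUnitNormal {n : ℕ} (Ω : Set (EuclideanSpace ℝ (Fin n)))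
    (x ν : EuclideanSpace ℝ (Fin n)) : Prop :=
  x ∈ frontier Ω ∧ ∃ v h r, IsLocalGraph Ω x v h r ∧
    ν = ‖v - gradient h x‖⁻¹ • (v - gradient h x)

/-- Surface measure on the boundary of `Ω`: the `(n-1)`-dimensional Hausdorff measure restricted
to the boundary (in Mathlib's normalization, a constant multiple of the usual one). -/
def surfaceMeasure {n : ℕ} (Ω : Set (EuclideanSpace ℝ (Fin n))) :
    Measure (EuclideanSpace ℝ (Fin n)) :=
  (Measure.hausdorffMeasure ((n : ℝ) - 1)).restrict (frontier Ω)

/-- The classical `i`-th partial derivative. -/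
def partialDeriv {n : ℕ} (i : Fin n) (φ : EuclideanSpace ℝ (Fin n) → ℝ)
    (x : EuclideanSpace ℝ (Fin n)) : ℝ :=
  fderiv ℝ φ x (EuclideanSpace.single i 1)

/-- `g` is the weak `i`-th partial derivative of `f` on `Ω`. -/
def IsWeakPartialDeriv {n : ℕ} (Ω : Set (EuclideanSpace ℝ (Fin n))) (i : Fin n)
    (f g : EuclideanSpace ℝ (Fin n) → ℝ) : Prop :=
  LocallyIntegrableOn f Ω ∧ LocallyIntegrableOn g Ω ∧
  ∀ φ : EuclideanSpace ℝ (Fin n) → ℝ, ContDiff ℝ ∞ φ → HasCompactSupport φ → tsupport φ ⊆ Ω →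
    ∫ x in Ω, f x * partialDeriv i φ x = -∫ x in Ω, g x * φ x

/-- `f` belongs to `L^∞(m)` and its norm there is at most `K`. -/
def LInftyBound {n : ℕ} (m : Measure (EuclideanSpace ℝ (Fin n)))
    (f : EuclideanSpace ℝ (Fin n) → ℝ) (K : ℝ≥0) : Prop :=
  AEStronglyMeasurable f m ∧ eLpNorm f ∞ m ≤ K

/-- `f` belongs to `W^{1,∞}(Ω)`, and `f` and its weak first derivatives have `L^∞(Ω)` norms at
most `K`. -/
def W1InftyBound {n : ℕ} (Ω : Set (EuclideanSpace ℝ (Fin n)))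
    (f : EuclideanSpace ℝ (Fin n) → ℝ) (K : ℝ≥0) : Prop :=
  LInftyBound (volume.restrict Ω) f K ∧
  ∀ k, ∃ g, IsWeakPartialDeriv Ω k f g ∧ LInftyBound (volume.restrict Ω) g K

/-- `f` belongs to `W^{1,∞}(∂Ω)` with norm at most `K`: on a compact hypersurface this is the space
of Lipschitz functions, normed by the supremum and the Lipschitz constant. -/
def W1InftyBoundaryBound {n : ℕ} (Ω : Set (EuclideanSpace ℝ (Fin n)))
    (f : EuclideanSpace ℝ (Fin n) → ℝ) (K : ℝ≥0) : Prop :=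
  (∀ x ∈ frontier Ω, |f x| ≤ K) ∧ LipschitzOnWith K f (frontier Ω)

/-- `f` belongs to `H¹(Ω)` and has weak gradient `Df`. -/
structure IsH1 {n : ℕ} (Ω : Set (EuclideanSpace ℝ (Fin n)))
    (f : EuclideanSpace ℝ (Fin n) → ℝ) (Df : Fin n → EuclideanSpace ℝ (Fin n) → ℝ) : Prop where
  memLp : MemLp f 2 (volume.restrict Ω)
  memLp_deriv : ∀ i, MemLp (Df i) 2 (volume.restrict Ω)
  weakDeriv : ∀ i, IsWeakPartialDeriv Ω i f (Df i)

/-- `u` belongs to `H²(Ω)`, with weak gradient `Du` and weak Hessian `D2u`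
(`D2u i j` is the derivative of `Du i` in direction `j`). -/
structure IsH2 {n : ℕ} (Ω : Set (EuclideanSpace ℝ (Fin n)))
    (u : EuclideanSpace ℝ (Fin n) → ℝ) (Du : Fin n → EuclideanSpace ℝ (Fin n) → ℝ)
    (D2u : Fin n → Fin n → EuclideanSpace ℝ (Fin n) → ℝ) : Prop where
  isH1 : IsH1 Ω u Du
  isH1_deriv : ∀ i, IsH1 Ω (Du i) (D2u i)

/-- `g ∈ L²(∂Ω)` is the boundary trace of `f ∈ H¹(Ω)`, whose weak gradient is `Df`: some functions
smooth up to the boundary converge to `f` in `H¹(Ω)` and to `g` in `L²(∂Ω)`. -/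
def IsTrace {n : ℕ} (Ω : Set (EuclideanSpace ℝ (Fin n)))
    (f : EuclideanSpace ℝ (Fin n) → ℝ) (Df : Fin n → EuclideanSpace ℝ (Fin n) → ℝ)
    (g : EuclideanSpace ℝ (Fin n) → ℝ) : Prop :=
  IsH1 Ω f Df ∧ MemLp g 2 (surfaceMeasure Ω) ∧
  ∃ φ : ℕ → EuclideanSpace ℝ (Fin n) → ℝ, (∀ k, ContDiff ℝ ∞ (φ k)) ∧
    Tendsto (fun k => eLpNorm (φ k - f) 2 (volume.restrict Ω)) atTop (𝓝 0) ∧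
    (∀ i, Tendsto (fun k => eLpNorm (partialDeriv i (φ k) - Df i) 2 (volume.restrict Ω))
      atTop (𝓝 0)) ∧
    Tendsto (fun k => eLpNorm (φ k - g) 2 (surfaceMeasure Ω)) atTop (𝓝 0)

/-- `u ∈ H²(Ω)` solves `a_ij u_ij + b_i u_i + c u = μ u` almost everywhere in `Ω` and
`β_i u_i + ℓ u = 0` almost everywhere on `∂Ω` in the sense of traces. -/
def IsH2Solution {n : ℕ} (Ω : Set (EuclideanSpace ℝ (Fin n)))
    (a : Fin n → Fin n → EuclideanSpace ℝ (Fin n) → ℝ)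
    (b : Fin n → EuclideanSpace ℝ (Fin n) → ℝ) (c : EuclideanSpace ℝ (Fin n) → ℝ)
    (β : Fin n → EuclideanSpace ℝ (Fin n) → ℝ) (l : EuclideanSpace ℝ (Fin n) → ℝ)
    (μ : ℝ) (u : EuclideanSpace ℝ (Fin n) → ℝ) : Prop :=
  ∃ (Du : Fin n → EuclideanSpace ℝ (Fin n) → ℝ)
    (D2u : Fin n → Fin n → EuclideanSpace ℝ (Fin n) → ℝ)
    (u₀ : EuclideanSpace ℝ (Fin n) → ℝ) (Du₀ : Fin n → EuclideanSpace ℝ (Fin n) → ℝ),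
    IsH2 Ω u Du D2u ∧
    IsTrace Ω u Du u₀ ∧ (∀ i, IsTrace Ω (Du i) (D2u i) (Du₀ i)) ∧
    (∀ᵐ x ∂(volume.restrict Ω),
      ∑ i, ∑ j, a i j x * D2u i j x + ∑ i, b i x * Du i x + c x * u x = μ * u x) ∧
    (∀ᵐ x ∂(surfaceMeasure Ω), ∑ i, β i x * Du₀ i x + l x * u₀ x = 0)

end

/-! This is an energy argument. Multiplying the equation by `u` and integrating by parts produces a
boundary integral containing the conormal derivative `a_ij N_j u_i`, whereas the boundary condition
controls the oblique derivative `β_i u_i`. Since the Hessian of `u` is symmetric, the second-order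
term does not change when an antisymmetric matrix is added to `a`. With `τ = a N - s β` and `s = ⟪a
N, N⟫ / ⟪β, N⟫`, the vector `τ` is orthogonal to `N`, and adding `(N ⊗ τ - τ ⊗ N) / |N|²` gives a
matrix `q` with `q N = s β`, `s ≥ 0`, and the same quadratic form as `a`
(`sum_obliqueMatrix_mul_normal`, `sum_obliqueMatrix_quadratic`). The boundary term becomes `-s ℓ
u²`, which is at most a constant times `ℓ⁻ u²`, and a trace inequality bounds it by integrals of
`|Du| |u|` and `u²`. Ellipticity bounds the integral of `q_ij u_i u_j` below by `λ` times that of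
`|Du|²`. Young's inequality absorbs the remaining gradient terms, and for large `μ` the integral of
`u²` must vanish.

The matrix `q` must be defined inside `Ω` with bounded first derivatives, so the work is local
(`exists_hasEnergyEstimate_boundary`): the normal `N = v - ∇h` of a graph chart is defined
everywhere, `β` has a Lipschitz extension, and on a small ball `⟪β, N⟫` stays positive. Both `a` and
`β` are replaced by smooth approximations obeying uniform `W^{1,∞}` bounds. The derivatives of `q`
enter only through such a bound, so the limit needs no convergence of derivatives
(`IsGaussGreenPatch.energy_estimate`). A partition of unity gives the estimate on all of `Ω`.

The divergence theorem below a graph is derived from that in a half space by a volume-preserving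
shear. Its boundary measure is only shown to be dominated by a multiple of the Hausdorff measure,
which suffices for using traces and the boundary condition. -/

noncomputable section

/-! ### Divergence theorem in the region below a graph. -/

namespace GraphDivergence

variable {E : Type*} [NormedAddCommGroup E] [InnerProductSpace ℝ E] [FiniteDimensional ℝ E]

/-- Splitting of the space into the hyperplane orthogonal to the unit vector `v` and the line
along `v`. -/
def splitEquiv (v : E) (hv : ‖v‖ = 1) : ((ℝ ∙ v)ᗮ × ℝ) ≃L[ℝ] E :=
  LinearEquiv.toContinuousLinearEquiv
    { toFun := fun p => (p.1 : E) + p.2 • v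
      map_add' := fun p q => by simp only [Prod.fst_add, Prod.snd_add, Submodule.coe_add]; module
      map_smul' := fun c p => by
        simp only [Prod.smul_fst, Prod.smul_snd, Submodule.coe_smul, RingHom.id_apply, smul_eq_mul]
        module
      invFun := fun y => ((ℝ ∙ v)ᗮ.orthogonalProjectionOnto y, inner ℝ v y)
      left_inv := fun p => by
        have h0 : inner ℝ v (p.1 : E) = 0 := Submodule.mem_orthogonal_singleton_iff_inner_right.1 p.1.2
        have h2 : (ℝ ∙ v)ᗮ.orthogonalProjectionOnto v = 0 := by
          rw [Submodule.orthogonalProjectionOnto_eq_zero_iff]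
          simp
        ext
        · simp [h2]
        · simp [inner_add_right, inner_smul_right, h0, hv]
      right_inv := fun y => by
        have := Submodule.starProjection_unit_singleton ℝ hv y
        have h3 := Submodule.starProjection_add_starProjection_orthogonal (K := (ℝ ∙ v)) y
        simp only
        rw [this] at h3
        rw [← Submodule.starProjection_apply]
        rw [add_comm]; exact h3 }

theorem splitEquiv_apply (v : E) (hv : ‖v‖ = 1) (p : (ℝ ∙ v)ᗮ × ℝ) :
    splitEquiv v hv p = (p.1 : E) + p.2 • v := rfl

variable [MeasurableSpace E] [BorelSpace E]

/-- Hausdorff measure on the hyperplane orthogonal to `v`. -/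
abbrev hyperplaneMeasure (v : E) : Measure (ℝ ∙ v)ᗮ :=
  Measure.hausdorffMeasure (Module.finrank ℝ (ℝ ∙ v)ᗮ)

instance (v : E) : (hyperplaneMeasure v).IsAddHaarMeasure := isAddHaarMeasure_hausdorffMeasure

/-- Uniqueness of Haar measure. The constant need not be identified: it only rescales the boundary
measure, which matters up to a factor. -/
theorem exists_volume_eq_smul_map (v : E) (hv : ‖v‖ = 1) : ∃ c : ℝ≥0,
    (volume : Measure E) =
      c • Measure.map (splitEquiv v hv) ((hyperplaneMeasure v).prod volume) := by
  have : (Measure.map (splitEquiv v hv) ((hyperplaneMeasure v).prod volume)).IsAddHaarMeasure :=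
    ContinuousLinearEquiv.isAddHaarMeasure_map _ _
  exact ⟨_, Measure.isAddLeftInvariant_eq_smul volume _⟩

/-- The shear carrying a half space onto the region below a graph. -/
def shear (v : E) (h : E → ℝ) (y : E) : E := y + h y • v

/-- In split coordinates the shear translates each line parallel to `v` by an amount depending only
on the hyperplane component, so it is a skew product of measure-preserving maps. -/
theorem measurePreserving_shear {v : E} (hv : ‖v‖ = 1) {h : E → ℝ} (hh : Continuous h)
    (hinv : ∀ (y : E) (t : ℝ), h (y + t • v) = h y) :
    MeasurePreserving (shear v h) (volume : Measure E) volume := by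
  obtain ⟨c, hc⟩ := exists_volume_eq_smul_map v hv
  set L := splitEquiv v hv
  have h1 : MeasurePreserving (fun p : (ℝ ∙ v)ᗮ × ℝ => (id p.1, p.2 + h p.1))
      ((hyperplaneMeasure v).prod volume) ((hyperplaneMeasure v).prod volume) := by
    refine MeasurePreserving.skew_product (μa := hyperplaneMeasure v)
      (g := fun (w : (ℝ ∙ v)ᗮ) (t : ℝ) => t + h w) (MeasurePreserving.id _) ?_ ?_
    · have : Continuous (Function.uncurry fun (w : (ℝ ∙ v)ᗮ) (t : ℝ) => t + h w) := by
        simp only [Function.uncurry_def]; fun_prop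
      exact this.measurable
    · exact Filter.Eventually.of_forall fun w => (measurePreserving_add_right volume (h w)).map_eq
  have hm : Measurable (shear v h) := by
    have : Continuous (shear v h) := by unfold shear; fun_prop
    exact this.measurable
  refine ⟨hm, ?_⟩
  have hL : Measurable L := L.continuous.measurable
  rw [hc, Measure.map_smul, Measure.map_map hm hL]
  congr 1
  have : shear v h ∘ L = L ∘ fun p : (ℝ ∙ v)ᗮ × ℝ => (id p.1, p.2 + h p.1) := by
    ext1 p
    simp only [Function.comp, shear, L, splitEquiv_apply, hinv, id]
    module
  rw [this, ← Measure.map_map hL h1.measurable, h1.map_eq]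

theorem integrable_comp_splitEquiv {v : E} (hv : ‖v‖ = 1) {f : E → ℝ} (hf : Continuous f)
    (hc : HasCompactSupport f) :
    Integrable (fun p => f (splitEquiv v hv p)) ((hyperplaneMeasure v).prod volume) :=
  (hf.comp (splitEquiv v hv).continuous).integrable_of_hasCompactSupport
    (hc.comp_homeomorph (splitEquiv v hv).toHomeomorph)

/-- Divergence theorem in a half space. -/
theorem integral_halfspace_fderiv {v : E} (hv : ‖v‖ = 1) {c : ℝ≥0}
    (hc : (volume : Measure E) =
      c • Measure.map (splitEquiv v hv) ((hyperplaneMeasure v).prod volume))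
    {G : E → ℝ} (hG : ContDiff ℝ 1 G) (hGc : HasCompactSupport G) (w : E) :
    ∫ y in {y : E | inner ℝ v y < 0}, fderiv ℝ G y w =
      inner ℝ v w * (c * ∫ z : (ℝ ∙ v)ᗮ, G z ∂(hyperplaneMeasure v)) := by
  set L := splitEquiv v hv
  have hL : MeasurableEmbedding L := L.toHomeomorph.measurableEmbedding
  have hS : MeasurableSet {y : E | inner ℝ v y < 0} :=
    (isOpen_lt (by fun_prop) continuous_const).measurableSet
  have hDc (w : E) : HasCompactSupport fun y => fderiv ℝ G y w := hGc.fderiv_apply ℝ w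
  have hDcont (w : E) : Continuous fun y => fderiv ℝ G y w :=
    (hG.continuous_fderiv one_ne_zero).clm_apply continuous_const
  have key (w : E) : ∫ y in {y : E | inner ℝ v y < 0}, fderiv ℝ G y w =
      c * ∫ p in univ ×ˢ Iio (0 : ℝ), fderiv ℝ G (L p) w ∂((hyperplaneMeasure v).prod volume) := by
    rw [hc, Measure.restrict_smul, integral_smul_nnreal_measure, hL.setIntegral_map]
    congr 3
    ext p
    have h0 : inner ℝ v (p.1 : E) = 0 := Submodule.mem_orthogonal_singleton_iff_inner_right.1 p.1.2
    simp [L, splitEquiv_apply, inner_add_right, inner_smul_right, h0, hv]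
  have hint (w : E) : IntegrableOn (fun p => fderiv ℝ G (L p) w) (univ ×ˢ Iio (0 : ℝ))
      ((hyperplaneMeasure v).prod volume) :=
    (integrable_comp_splitEquiv hv (hDcont w) (hDc w)).integrableOn
  -- the normal direction
  have hnormal : ∫ y in {y : E | inner ℝ v y < 0}, fderiv ℝ G y v =
      c * ∫ z : (ℝ ∙ v)ᗮ, G z ∂(hyperplaneMeasure v) := by
    rw [key, setIntegral_prod _ (hint v)]
    congr 1
    rw [setIntegral_univ]
    refine integral_congr_ae (Filter.Eventually.of_forall fun z => ?_)
    simp only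
    rw [← integral_Iic_eq_integral_Iio]
    have hline (t : ℝ) : HasDerivAt (fun t : ℝ => (z : E) + t • v) v t := by
      simpa using ((hasDerivAt_id t).smul_const v).const_add (z : E)
    have hder : deriv (fun t : ℝ => G (z + t • v)) = fun t => fderiv ℝ G (L (z, t)) v := by
      ext t
      exact ((hG.differentiable one_ne_zero _).hasFDerivAt.comp_hasDerivAt t (hline t)).deriv
    have hcomp : HasCompactSupport (fun t : ℝ => G (z + t • v)) := by
      refine hGc.comp_isClosedEmbedding (g := fun t : ℝ => (z : E) + t • v) ?_
      have h1 : Topology.IsClosedEmbedding (fun t : ℝ => t • v) :=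
        isClosedEmbedding_smul_left (by intro h; simp [h] at hv)
      exact (Homeomorph.addLeft (z : E)).isClosedEmbedding.comp h1
    have := HasCompactSupport.integral_Iic_deriv_eq (hG.comp (by fun_prop)) hcomp 0
    simp only [Function.comp_def, hder] at this
    simpa using this
  -- tangential directions
  have htang (p : (ℝ ∙ v)ᗮ) : ∫ y in {y : E | inner ℝ v y < 0}, fderiv ℝ G y p = 0 := by
    have hi := hint p
    rw [IntegrableOn, ← Measure.prod_restrict, Measure.restrict_univ] at hi
    rw [key, ← Measure.prod_restrict, Measure.restrict_univ, integral_prod_symm _ hi]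
    have hzero (t : ℝ) : ∫ z : (ℝ ∙ v)ᗮ, fderiv ℝ G (L (z, t)) p ∂(hyperplaneMeasure v) = 0 := by
      have hgc : HasCompactSupport (fun z : (ℝ ∙ v)ᗮ => G (z + t • v)) :=
        hGc.comp_isClosedEmbedding ((Homeomorph.addRight (t • v)).isClosedEmbedding.comp
          (Submodule.closed_of_finiteDimensional _).isClosedEmbedding_subtypeVal)
      have hg : ContDiff ℝ 1 (fun z : (ℝ ∙ v)ᗮ => G (z + t • v)) :=
        hG.comp (((ℝ ∙ v)ᗮ.subtypeL.contDiff).add contDiff_const)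
      have hder (z : (ℝ ∙ v)ᗮ) : fderiv ℝ (fun z : (ℝ ∙ v)ᗮ => G (z + t • v)) z p =
          fderiv ℝ G (L (z, t)) p := by
        have h1 : HasFDerivAt (fun z : (ℝ ∙ v)ᗮ => (z : E) + t • v) (ℝ ∙ v)ᗮ.subtypeL z :=
          (ℝ ∙ v)ᗮ.subtypeL.hasFDerivAt.add_const (t • v)
        have h2 := ((hG.differentiable one_ne_zero ((z : E) + t • v)).hasFDerivAt.comp z h1).fderiv
        rw [Function.comp_def] at h2
        rw [h2]
        rfl
      -- Integration by parts against the constant `1`: a derivative of a compactly supported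
      -- function has integral zero.
      have := integral_mul_fderiv_eq_neg_fderiv_mul_of_integrable (μ := hyperplaneMeasure v)
        (f := fun _ => (1 : ℝ)) (g := fun z : (ℝ ∙ v)ᗮ => G (z + t • v)) (v := p) (by simp)
        (by
          simp only [one_mul]
          exact ((hg.continuous_fderiv one_ne_zero).clm_apply
            continuous_const).integrable_of_hasCompactSupport (hgc.fderiv_apply ℝ p))
        (by simpa using hg.continuous.integrable_of_hasCompactSupport hgc)
        (fun _ _ => differentiableAt_const _) (fun _ _ => hg.differentiable one_ne_zero _)
      simpa [hder] using this
    simp [hzero]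
  have hw := Submodule.starProjection_add_starProjection_orthogonal (K := (ℝ ∙ v)) w
  rw [Submodule.starProjection_unit_singleton ℝ hv w] at hw
  have hsplit (y : E) : fderiv ℝ G y w = inner ℝ v w * fderiv ℝ G y v +
      fderiv ℝ G y ((ℝ ∙ v)ᗮ.orthogonalProjectionOnto w) := by
    conv_lhs => rw [← hw]
    rw [map_add, map_smul, smul_eq_mul, Submodule.starProjection_apply]
  have hI (w : E) : Integrable fun y => fderiv ℝ G y w :=
    (hDcont w).integrable_of_hasCompactSupport (hDc w)
  simp_rw [hsplit]
  rw [integral_add ((hI v).integrableOn.const_mul _) (hI _).integrableOn, integral_const_mul,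
    hnormal, htang, add_zero]

/-- A constant multiple of the measure carried by the graph of `h` whose projection along `v` is
the Hausdorff measure of the hyperplane. -/
def graphMeasure (v : E) (h : E → ℝ) (c : ℝ≥0) : Measure E :=
  c • Measure.map (fun z : (ℝ ∙ v)ᗮ => shear v h z) (hyperplaneMeasure v)

omit [FiniteDimensional ℝ E] [MeasurableSpace E] [BorelSpace E] in
theorem continuous_shear {v : E} {h : E → ℝ} (hh : Continuous h) : Continuous (shear v h) := by
  unfold shear; fun_prop

omit [FiniteDimensional ℝ E] [MeasurableSpace E] [BorelSpace E] in
theorem hasCompactSupport_comp_shear {v : E} {h : E → ℝ} (hh : Continuous h)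
    (hinv : ∀ (y : E) (t : ℝ), h (y + t • v) = h y) {G : E → ℝ} (hGc : HasCompactSupport G) :
    HasCompactSupport (fun y => G (shear v h y)) := by
  let e : E ≃ₜ E :=
    { toFun := shear v h
      invFun := fun y => y - h y • v
      left_inv := fun y => by simp [shear, hinv]
      right_inv := fun y => by
        have := hinv y (-h y)
        rw [neg_smul, ← sub_eq_add_neg] at this
        simp [shear, this]
      continuous_toFun := continuous_shear hh
      continuous_invFun := by fun_prop }
  exact hGc.comp_homeomorph e

/-- Divergence theorem in the region below a graph. -/
theorem integral_subgraph_fderiv {v : E} (hv : ‖v‖ = 1) {c : ℝ≥0}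
    (hc : (volume : Measure E) =
      c • Measure.map (splitEquiv v hv) ((hyperplaneMeasure v).prod volume))
    {h : E → ℝ} (hh : ContDiff ℝ ∞ h) (hinv : ∀ (y : E) (t : ℝ), h (y + t • v) = h y)
    {G : E → ℝ} (hG : ContDiff ℝ 1 G) (hGc : HasCompactSupport G) (w : E) :
    ∫ y in {y : E | inner ℝ v y < h y}, fderiv ℝ G y w =
      ∫ y, G y * inner ℝ (v - gradient h y) w ∂(graphMeasure v h c) := by
  have hh1 : ContDiff ℝ 1 h := hh.of_le (by exact_mod_cast le_top)
  have hhd (y : E) : HasFDerivAt h (fderiv ℝ h y) y :=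
    (hh1.differentiable one_ne_zero y).hasFDerivAt
  have hDinv (y : E) (t : ℝ) : fderiv ℝ h (y + t • v) = fderiv ℝ h y := by
    have : (fun x => h (x + t • v)) = h := by ext x; exact hinv x t
    rw [← fderiv_comp_add_right (f := h), this]
  have hDv (y : E) : fderiv ℝ h y v = 0 := by
    have h1 : HasDerivAt (fun t : ℝ => y + t • v) v 0 := by
      simpa using ((hasDerivAt_id (0 : ℝ)).smul_const v).const_add y
    have h2 := (show HasFDerivAt h (fderiv ℝ h y) (y + (0 : ℝ) • v) by
      simpa using hhd y).comp_hasDerivAt 0 h1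
    have h3 : (h ∘ fun t : ℝ => y + t • v) = fun _ => h y := by ext t; simp [hinv]
    rw [h3] at h2
    exact h2.unique (hasDerivAt_const _ _)
  have hG1 : ContDiff ℝ 1 (fun y => G (shear v h y)) :=
    hG.comp (contDiff_id.add (hh1.smul contDiff_const))
  have hshear (y : E) : HasFDerivAt (shear v h)
      (ContinuousLinearMap.id ℝ E + (fderiv ℝ h y).smulRight v) y :=
    (hasFDerivAt_id y).add ((hhd y).smul_const v)
  have hcomp (y w : E) : fderiv ℝ (fun y => G (shear v h y)) y w =
      fderiv ℝ G (shear v h y) w + fderiv ℝ h y w * fderiv ℝ G (shear v h y) v := by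
    have := ((hG.differentiable one_ne_zero (shear v h y)).hasFDerivAt.comp y (hshear y)).fderiv
    rw [Function.comp_def] at this
    rw [this]
    simp
  have hk : ContDiff ℝ 1 fun y => fderiv ℝ h y w :=
    (((contDiff_infty.1 hh 2).fderiv_right (m := 1) (by norm_num)).clm_apply contDiff_const)
  have hkder (y : E) : fderiv ℝ (fun y => fderiv ℝ h y w * G (shear v h y)) y v =
      fderiv ℝ h y w * fderiv ℝ G (shear v h y) v := by
    have h0 : fderiv ℝ (fun y => fderiv ℝ h y w) y v = 0 := by
      have h1 : HasDerivAt (fun t : ℝ => y + t • v) v 0 := by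
        simpa using ((hasDerivAt_id (0 : ℝ)).smul_const v).const_add y
      have h2 := (show HasFDerivAt (fun y => fderiv ℝ h y w)
        (fderiv ℝ (fun y => fderiv ℝ h y w) y) (y + (0 : ℝ) • v) by
        simpa using (hk.differentiable one_ne_zero y).hasFDerivAt).comp_hasDerivAt 0 h1
      have h3 : ((fun y => fderiv ℝ h y w) ∘ fun t : ℝ => y + t • v) =
          fun _ => fderiv ℝ h y w := by ext t; simp [hDinv]
      rw [h3] at h2
      exact h2.unique (hasDerivAt_const _ _)
    rw [fderiv_fun_mul (hk.differentiable one_ne_zero y) (hG1.differentiable one_ne_zero y)]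
    simp [h0, hcomp, hDv]
  have hcs := hasCompactSupport_comp_shear hh1.continuous hinv hGc
  have hI1 : Integrable fun y => fderiv ℝ (fun y => G (shear v h y)) y w :=
    ((hG1.continuous_fderiv one_ne_zero).clm_apply
      continuous_const).integrable_of_hasCompactSupport (hcs.fderiv_apply ℝ w)
  have hI2 : Integrable fun y => fderiv ℝ (fun y => fderiv ℝ h y w * G (shear v h y)) y v :=
    (((hk.mul hG1).continuous_fderiv one_ne_zero).clm_apply
      continuous_const).integrable_of_hasCompactSupport ((hcs.mul_left).fderiv_apply ℝ v)
  have hpre : shear v h ⁻¹' {y : E | inner ℝ v y < h y} = {y : E | inner ℝ v y < 0} := by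
    ext y
    simp [shear, hinv, inner_add_right, inner_smul_right, hv]
  have hSm : MeasurableSet {y : E | inner ℝ v y < h y} :=
    (isOpen_lt (by fun_prop) hh1.continuous).measurableSet
  have hmp := measurePreserving_shear hv hh1.continuous hinv
  have hDG : Continuous fun y => fderiv ℝ G y w :=
    (hG.continuous_fderiv one_ne_zero).clm_apply continuous_const
  have hchange : ∫ y in {y : E | inner ℝ v y < h y}, fderiv ℝ G y w =
      ∫ y in {y : E | inner ℝ v y < 0}, fderiv ℝ G (shear v h y) w := by
    conv_lhs => rw [← hmp.map_eq]
    rw [setIntegral_map hSm hDG.aestronglyMeasurable hmp.measurable.aemeasurable, hpre]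
  -- The chain rule leaves the extra term `∂_w h · ∂_v G`. Since `∂_w h` is constant along `v`, this
  -- term is itself a `v`-derivative, so the half-space theorem applies to both pieces; their
  -- boundary densities combine to `⟪v, w⟫ - ∂_w h = ⟪v - ∇h, w⟫`.
  have hpt (y : E) : fderiv ℝ G (shear v h y) w =
      fderiv ℝ (fun y => G (shear v h y)) y w -
        fderiv ℝ (fun y => fderiv ℝ h y w * G (shear v h y)) y v := by
    rw [hcomp, hkder]; ring
  have hvv : inner ℝ v v = (1 : ℝ) := by simp [hv]
  have hm : Measurable fun z : (ℝ ∙ v)ᗮ => shear v h z :=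
    ((continuous_shear hh1.continuous).comp continuous_subtype_val).measurable
  have hgrad : Continuous fun y => gradient h y := by
    unfold gradient
    exact (InnerProductSpace.toDual ℝ E).symm.continuous.comp (hh1.continuous_fderiv one_ne_zero)
  have hFc : Continuous fun y => G y * inner ℝ (v - gradient h y) w :=
    hG.continuous.mul ((continuous_const.sub hgrad).inner continuous_const)
  have hcontW : Continuous fun z : (ℝ ∙ v)ᗮ => fderiv ℝ h z w := hk.continuous.comp (by fun_prop)
  have hIW : Integrable (fun z : (ℝ ∙ v)ᗮ => G (shear v h z)) (hyperplaneMeasure v) :=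
    (hG1.continuous.comp continuous_subtype_val).integrable_of_hasCompactSupport
      (hcs.comp_isClosedEmbedding
        (Submodule.closed_of_finiteDimensional _).isClosedEmbedding_subtypeVal)
  have hIW2 : Integrable (fun z : (ℝ ∙ v)ᗮ => fderiv ℝ h z w * G (shear v h z))
      (hyperplaneMeasure v) :=
    (hcontW.mul (hG1.continuous.comp continuous_subtype_val)).integrable_of_hasCompactSupport
      (hcs.comp_isClosedEmbedding
        (Submodule.closed_of_finiteDimensional _).isClosedEmbedding_subtypeVal).mul_left
  rw [hchange]
  simp_rw [hpt]
  rw [integral_sub hI1.integrableOn hI2.integrableOn,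
    integral_halfspace_fderiv hv hc hG1 hcs, integral_halfspace_fderiv hv hc (hk.mul hG1)
      (hcs.mul_left), hvv, one_mul, graphMeasure, integral_smul_nnreal_measure,
    integral_map hm.aemeasurable hFc.aestronglyMeasurable, NNReal.smul_def, smul_eq_mul,
    mul_left_comm, ← mul_sub, ← integral_const_mul, ← integral_sub (hIW.const_mul _) hIW2]
  congr 1
  refine integral_congr_ae (Filter.Eventually.of_forall fun z => ?_)
  have hg : gradient h (shear v h z) = gradient h z := by
    unfold gradient shear; rw [hDinv]
  simp only [hg, inner_sub_left, inner_gradient_left]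
  ring

-- Orthogonal projection to the hyperplane is 1-Lipschitz and inverts the parametrization of the
-- graph, so it cannot increase Hausdorff measure. This inequality replaces the area formula.
omit [FiniteDimensional ℝ E] in
theorem graphMeasure_apply_le {v : E} (hv : ‖v‖ = 1) {h : E → ℝ} (hh : Continuous h)
    (hinv : ∀ (y : E) (t : ℝ), h (y + t • v) = h y) (c : ℝ≥0) {S : Set E} (hS : MeasurableSet S) :
    graphMeasure v h c S ≤
      c * Measure.hausdorffMeasure (Module.finrank ℝ (ℝ ∙ v)ᗮ) (S ∩ {y | inner ℝ v y = h y}) := by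
  have hm : Measurable fun z : (ℝ ∙ v)ᗮ => shear v h z :=
    ((continuous_shear hh).comp continuous_subtype_val).measurable
  have hlip : LipschitzWith 1 ((ℝ ∙ v)ᗮ.orthogonalProjectionOnto) :=
    Submodule.lipschitzWith_orthogonalProjectionOnto _
  have hvp : (ℝ ∙ v)ᗮ.orthogonalProjectionOnto v = 0 := by
    rw [Submodule.orthogonalProjectionOnto_eq_zero_iff]; simp
  rw [graphMeasure, Measure.smul_apply, Measure.map_apply hm hS, ENNReal.smul_def, smul_eq_mul]
  gcongr
  have hsub : (fun z : (ℝ ∙ v)ᗮ => shear v h z) ⁻¹' S ⊆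
      (ℝ ∙ v)ᗮ.orthogonalProjectionOnto '' (S ∩ {y | inner ℝ v y = h y}) := by
    intro z hz
    have h0 : inner ℝ v (z : E) = 0 := Submodule.mem_orthogonal_singleton_iff_inner_right.1 z.2
    refine ⟨shear v h z, ⟨hz, ?_⟩, ?_⟩
    · simp [shear, hinv, inner_add_right, inner_smul_right, h0, hv]
    · simp [shear, hvp]
  refine (measure_mono hsub).trans ?_
  simpa using hlip.hausdorffMeasure_image_le (d := Module.finrank ℝ (ℝ ∙ v)ᗮ) (by positivity) _

end GraphDivergence

end

/-! ### Local Gauss-Green formulas for a smooth domain. -/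

section

theorem IsLocalGraph.mem_frontier {n : ℕ} {Ω : Set (EuclideanSpace ℝ (Fin n))}
    {x v : EuclideanSpace ℝ (Fin n)} {h : EuclideanSpace ℝ (Fin n) → ℝ} {r : ℝ}
    (H : IsLocalGraph Ω x v h r) (hΩ : IsOpen Ω) {y : EuclideanSpace ℝ (Fin n)}
    (hy : y ∈ Metric.ball x r) (hyv : inner ℝ v y = h y) : y ∈ frontier Ω := by
  have hmem (z : EuclideanSpace ℝ (Fin n)) (hz : z ∈ Metric.ball x r) :
      z ∈ Ω ↔ inner ℝ v z < h z := by
    have := Set.ext_iff.1 H.inter_ball z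
    simpa [Metric.mem_ball.1 hz] using this
  rw [hΩ.frontier_eq]
  refine ⟨?_, fun hyΩ => ?_⟩
  · have ht : Tendsto (fun t : ℝ => y + (-t) • v) (𝓝[>] 0) (𝓝 y) := by
      have : Continuous fun t : ℝ => y + (-t) • v := by fun_prop
      simpa using (this.tendsto 0).mono_left nhdsWithin_le_nhds
    refine mem_closure_of_tendsto ht ?_
    filter_upwards [ht (Metric.isOpen_ball.mem_nhds hy), self_mem_nhdsWithin] with t ht1 ht2
    rw [hmem _ ht1, H.invariant]
    have : (0 : ℝ) < t := ht2
    simp [inner_add_right, inner_smul_right, H.norm_eq_one, hyv, this]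
  · exact absurd ((hmem y hy).1 hyΩ) (by simp [hyv])

theorem IsLocalGraph.inner_le_of_mem_closure {n : ℕ} {Ω : Set (EuclideanSpace ℝ (Fin n))}
    {x v : EuclideanSpace ℝ (Fin n)} {h : EuclideanSpace ℝ (Fin n) → ℝ} {r : ℝ}
    (H : IsLocalGraph Ω x v h r) {y : EuclideanSpace ℝ (Fin n)}
    (hy : y ∈ Metric.ball x r) (hyΩ : y ∈ closure Ω) : inner ℝ v y ≤ h y := by
  have h1 : y ∈ closure (Ω ∩ Metric.ball x r) := by
    rw [mem_closure_iff_nhds] at hyΩ ⊢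
    intro t ht
    obtain ⟨z, hz⟩ := hyΩ _ (inter_mem ht (Metric.isOpen_ball.mem_nhds hy))
    exact ⟨z, hz.1.1, hz.2, hz.1.2⟩
  have h2 : IsClosed {y : EuclideanSpace ℝ (Fin n) | inner ℝ v y ≤ h y} :=
    isClosed_le (by fun_prop) H.contDiff.continuous
  refine closure_minimal ?_ h2 h1
  rw [H.inter_ball]
  exact fun z hz => hz.2.le

/-- Restriction of a local graph representation to a smaller ball. -/
theorem IsLocalGraph.mono {n : ℕ} {Ω : Set (EuclideanSpace ℝ (Fin n))}
    {x y v : EuclideanSpace ℝ (Fin n)} {h : EuclideanSpace ℝ (Fin n) → ℝ} {r s : ℝ}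
    (H : IsLocalGraph Ω x v h r) (hs : 0 < s) (hsub : Metric.ball y s ⊆ Metric.ball x r) :
    IsLocalGraph Ω y v h s := by
  refine ⟨hs, H.norm_eq_one, H.contDiff, H.invariant, ?_⟩
  have := H.inter_ball
  ext z
  have hz := Set.ext_iff.1 this z
  simp only [mem_inter_iff, mem_ofPred_eq] at hz ⊢
  constructor
  · rintro ⟨h1, h2⟩
    exact ⟨h2, (hz.1 ⟨h1, hsub h2⟩).2⟩
  · rintro ⟨h1, h2⟩
    exact ⟨(hz.2 ⟨hsub h1, h2⟩).1, h1⟩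

/-- In the open set `U`, the divergence theorem for `Ω` holds with boundary measure `σ`, dominated
by a multiple of the surface measure, and with (not normalized) normal field `N`. -/
structure IsGaussGreenPatch {n : ℕ} (Ω U : Set (EuclideanSpace ℝ (Fin n)))
    (σ : Measure (EuclideanSpace ℝ (Fin n)))
    (N : EuclideanSpace ℝ (Fin n) → EuclideanSpace ℝ (Fin n)) : Prop where
  exists_le_smul : ∃ C : ℝ≥0, σ ≤ C • surfaceMeasure Ω
  continuous : Continuous N
  integral_fderiv : ∀ G : EuclideanSpace ℝ (Fin n) → ℝ, ContDiff ℝ 1 G → HasCompactSupport G →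
    tsupport G ⊆ U → ∀ w, ∫ y in Ω, fderiv ℝ G y w = ∫ y, G y * inner ℝ (N y) w ∂σ

/-- Compact support inside `Ω` leaves no boundary term. With zero boundary measure, interior and
boundary patches can share one energy estimate. -/
theorem isGaussGreenPatch_interior {n : ℕ} (Ω : Set (EuclideanSpace ℝ (Fin n))) :
    IsGaussGreenPatch Ω Ω 0 (fun _ => 0) := by
  refine ⟨⟨0, by simp⟩, continuous_const, fun G hG hGc hGΩ w => ?_⟩
  have h1 : ∫ y in Ω, fderiv ℝ G y w = ∫ y, fderiv ℝ G y w := by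
    refine setIntegral_eq_integral_of_forall_compl_eq_zero fun y hy => ?_
    have : y ∉ tsupport (fderiv ℝ G) := fun h => hy (hGΩ (tsupport_fderiv_subset ℝ h))
    rw [image_eq_zero_of_notMem_tsupport this]; simp
  have hD : Continuous fun y => fderiv ℝ G y w :=
    (hG.continuous_fderiv one_ne_zero).clm_apply continuous_const
  have := integral_mul_fderiv_eq_neg_fderiv_mul_of_integrable
    (μ := (volume : Measure (EuclideanSpace ℝ (Fin n))))
    (f := fun _ => (1 : ℝ)) (g := G) (v := w) (by simp)
    (by simpa using hD.integrable_of_hasCompactSupport (hGc.fderiv_apply ℝ w))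
    (by simpa using hG.continuous.integrable_of_hasCompactSupport hGc)
    (fun _ _ => differentiableAt_const _) (fun _ _ => hG.differentiable one_ne_zero _)
  rw [h1]
  simpa using this

theorem continuous_gradient {n : ℕ} {h : EuclideanSpace ℝ (Fin n) → ℝ} (hh : ContDiff ℝ ∞ h) :
    Continuous (gradient h) :=
  (InnerProductSpace.toDual ℝ (EuclideanSpace ℝ (Fin n))).symm.continuous.comp
    (hh.continuous_fderiv (by simp))

/-- The measure is the graph measure cut down to the ball. That it charges only the frontier allows
facts known merely on the frontier, such as the agreement of `β` with its extension, to be used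
almost everywhere. -/
theorem IsLocalGraph.exists_isGaussGreenPatch {n : ℕ} (hn : 1 ≤ n)
    {Ω : Set (EuclideanSpace ℝ (Fin n))}
    {x v : EuclideanSpace ℝ (Fin n)} {h : EuclideanSpace ℝ (Fin n) → ℝ} {r : ℝ}
    (H : IsLocalGraph Ω x v h r) (hΩ : IsOpen Ω) :
    ∃ σ, IsGaussGreenPatch Ω (Metric.ball x r) σ (fun y => v - gradient h y) ∧
      σ (frontier Ω ∩ Metric.ball x r)ᶜ = 0 := by
  have hv := H.norm_eq_one
  obtain ⟨c, hc⟩ := GraphDivergence.exists_volume_eq_smul_map v hv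
  -- The surface measure has the real exponent `n - 1`, the hyperplane a natural dimension `n - 1`;
  -- they agree because `1 ≤ n`.
  have hfin : ((Module.finrank ℝ (ℝ ∙ v)ᗮ : ℕ) : ℝ) = (n : ℝ) - 1 := by
    have : Fact (Module.finrank ℝ (EuclideanSpace ℝ (Fin n)) = (n - 1) + 1) := ⟨by simp; omega⟩
    rw [Submodule.finrank_orthogonal_span_singleton (n := n - 1) (by rintro rfl; simp at hv),
      Nat.cast_sub hn]
    simp
  have hle (S : Set (EuclideanSpace ℝ (Fin n))) (hS : MeasurableSet S) :=
    GraphDivergence.graphMeasure_apply_le hv H.contDiff.continuous H.invariant c hS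
  have hfr : MeasurableSet (frontier Ω) := isClosed_frontier.measurableSet
  have hsub (S : Set (EuclideanSpace ℝ (Fin n))) :
      S ∩ Metric.ball x r ∩ {y | inner ℝ v y = h y} ⊆ S ∩ (frontier Ω ∩ Metric.ball x r) :=
    fun y hy => ⟨hy.1.1, H.mem_frontier hΩ hy.1.2 hy.2, hy.1.2⟩
  refine ⟨(GraphDivergence.graphMeasure v h c).restrict (Metric.ball x r), ⟨⟨c, ?_⟩,
    continuous_const.sub (continuous_gradient H.contDiff), fun G hG hGc hGU w => ?_⟩, ?_⟩
  · refine Measure.le_iff.2 fun S hS => ?_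
    rw [Measure.restrict_apply hS]
    refine (hle _ (hS.inter Metric.isOpen_ball.measurableSet)).trans ?_
    rw [Measure.smul_apply, surfaceMeasure, Measure.restrict_apply hS, hfin, ENNReal.smul_def,
      smul_eq_mul]
    exact mul_le_mul' le_rfl (measure_mono
      ((hsub S).trans (inter_subset_inter_right _ inter_subset_left)))
  · have h0 (y) (hy : y ∉ Metric.ball x r) : fderiv ℝ G y w = 0 := by
      have : y ∉ tsupport (fderiv ℝ G) := fun h => hy (hGU (tsupport_fderiv_subset ℝ h))
      rw [image_eq_zero_of_notMem_tsupport this]; simp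
    have h1 (S : Set (EuclideanSpace ℝ (Fin n))) : ∫ y in S, fderiv ℝ G y w =
        ∫ y in S ∩ Metric.ball x r, fderiv ℝ G y w := by
      rw [inter_comm, ← Measure.restrict_restrict Metric.isOpen_ball.measurableSet]
      exact (setIntegral_eq_integral_of_forall_compl_eq_zero h0).symm
    rw [h1, H.inter_ball]
    have h2 : {y | y ∈ Metric.ball x r ∧ inner ℝ v y < h y} =
      {y | inner ℝ v y < h y} ∩ Metric.ball x r := by ext; simp [and_comm]
    rw [h2, ← h1, GraphDivergence.integral_subgraph_fderiv hv hc H.contDiff H.invariant hG hGc]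
    refine (setIntegral_eq_integral_of_forall_compl_eq_zero fun y hy => ?_).symm
    rw [image_eq_zero_of_notMem_tsupport fun h => hy (hGU h), zero_mul]
  · have hm : MeasurableSet (frontier Ω ∩ Metric.ball x r)ᶜ :=
      (hfr.inter Metric.isOpen_ball.measurableSet).compl
    rw [Measure.restrict_apply hm]
    refine le_antisymm ((hle _ (hm.inter Metric.isOpen_ball.measurableSet)).trans ?_) zero_le
    have : (frontier Ω ∩ Metric.ball x r)ᶜ ∩ Metric.ball x r ∩ {y | inner ℝ v y = h y} = ∅ := by
      refine subset_empty_iff.1 ((hsub _).trans ?_)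
      rw [compl_inter_self]
    rw [this]
    simp

end

/-! ### Limits of products in `L²` and integration by parts with traces. -/

section

section L2Limits

variable {α : Type*} [MeasurableSpace α] {m : Measure α}

theorem tendsto_eLpNorm_mul_mul_zero {q : α → ℝ} {C : ℝ} (hqC : ∀ x, |q x| ≤ C)
    {A B : ℕ → α → ℝ} (hA : ∀ k, AEStronglyMeasurable (A k) m)
    (hB : ∀ k, AEStronglyMeasurable (B k) m) {M : ℝ≥0}
    (hBM : ∀ᶠ k in atTop, eLpNorm (B k) 2 m ≤ M)
    (hA0 : Tendsto (fun k => eLpNorm (A k) 2 m) atTop (𝓝 0)) :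
    Tendsto (fun k => eLpNorm (fun x => q x * A k x * B k x) 1 m) atTop (𝓝 0) := by
  have hlim : Tendsto (fun k => (C.toNNReal : ℝ≥0∞) * eLpNorm (A k) 2 m * M) atTop (𝓝 0) := by
    have h1 : Tendsto (fun k => (C.toNNReal : ℝ≥0∞) * eLpNorm (A k) 2 m) atTop (𝓝 0) := by
      simpa using ENNReal.Tendsto.const_mul hA0 (Or.inr (ENNReal.coe_ne_top (r := C.toNNReal)))
    simpa using ENNReal.Tendsto.mul_const h1 (Or.inr (ENNReal.coe_ne_top (r := M)))
  refine tendsto_of_tendsto_of_tendsto_of_le_of_le' tendsto_const_nhds hlim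
    (Eventually.of_forall fun _ => zero_le) ?_
  filter_upwards [hBM] with k hk
  calc eLpNorm (fun x => q x * A k x * B k x) 1 m
      ≤ C.toNNReal * eLpNorm (fun x => A k x * B k x) 1 m := by
        refine eLpNorm_le_nnreal_smul_eLpNorm_of_ae_le_mul (Eventually.of_forall fun x => ?_) 1
        rw [← NNReal.coe_le_coe]
        have h0 : 0 ≤ C := (abs_nonneg _).trans (hqC x)
        simp only [coe_nnnorm, NNReal.coe_mul, Real.coe_toNNReal _ h0, mul_assoc, norm_mul]
        exact mul_le_mul_of_nonneg_right (hqC x) (by positivity)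
    _ ≤ C.toNNReal * ((1 : ℝ≥0) * eLpNorm (A k) 2 m * eLpNorm (B k) 2 m) := by
        gcongr
        exact eLpNorm_le_eLpNorm_mul_eLpNorm_of_nnnorm (hA k) (hB k) (· * ·) 1
          (Eventually.of_forall fun x => by simp [nnnorm_mul])
    _ ≤ C.toNNReal * eLpNorm (A k) 2 m * M := by
        rw [ENNReal.coe_one, one_mul, ← mul_assoc]
        gcongr

theorem integrable_bdd_mul_mul {q : α → ℝ} {C : ℝ} (hq : AEStronglyMeasurable q m)
    (hqC : ∀ᵐ x ∂m, |q x| ≤ C) {f g : α → ℝ} (hf : MemLp f 2 m) (hg : MemLp g 2 m) :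
    Integrable (fun x => q x * f x * g x) m := by
  simp_rw [mul_assoc]
  exact (hf.integrable_mul hg).bdd_mul hq hqC

theorem memLp_of_tendsto_eLpNorm_sub {F : ℕ → α → ℝ} {f : α → ℝ}
    (hF : ∀ k, AEStronglyMeasurable (F k) m) (hf : MemLp f 2 m)
    (hlim : Tendsto (fun k => eLpNorm (F k - f) 2 m) atTop (𝓝 0)) :
    ∀ᶠ k in atTop, MemLp (F k) 2 m := by
  filter_upwards [hlim.eventually (gt_mem_nhds one_pos)] with k hk
  have h1 : MemLp (F k - f) 2 m := ⟨(hF k).sub hf.1, hk.trans ENNReal.one_lt_top⟩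
  simpa using h1.add hf

theorem tendsto_integral_mul_mul {q : α → ℝ} {C : ℝ} (hq : AEStronglyMeasurable q m)
    (hqC : ∀ x, |q x| ≤ C) {F G : ℕ → α → ℝ} {f g : α → ℝ}
    (hF : ∀ k, AEStronglyMeasurable (F k) m) (hG : ∀ k, AEStronglyMeasurable (G k) m)
    (hf : MemLp f 2 m) (hg : MemLp g 2 m)
    (hFf : Tendsto (fun k => eLpNorm (F k - f) 2 m) atTop (𝓝 0))
    (hGg : Tendsto (fun k => eLpNorm (G k - g) 2 m) atTop (𝓝 0)) :
    Tendsto (fun k => ∫ x, q x * F k x * G k x ∂m) atTop (𝓝 (∫ x, q x * f x * g x ∂m)) := by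
  refine tendsto_integral_of_L1' _
    (integrable_bdd_mul_mul hq (Eventually.of_forall hqC) hf hg).1 ?_ ?_
  · filter_upwards [memLp_of_tendsto_eLpNorm_sub hF hf hFf,
      memLp_of_tendsto_eLpNorm_sub hG hg hGg] with k h1 h2
    exact integrable_bdd_mul_mul hq (Eventually.of_forall hqC) h1 h2
  · have hb : ∀ᶠ k in atTop, eLpNorm (G k) 2 m ≤ ((1 + (eLpNorm g 2 m).toNNReal : ℝ≥0) : ℝ≥0∞) := by
      filter_upwards [hGg.eventually (gt_mem_nhds one_pos)] with k hk
      have h1 := eLpNorm_add_le ((hG k).sub hg.1) hg.1 (p := 2) (by norm_num)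
      rw [sub_add_cancel] at h1
      rw [ENNReal.coe_add, ENNReal.coe_toNNReal hg.2.ne, ENNReal.coe_one]
      exact h1.trans (by gcongr)
    have h1 := tendsto_eLpNorm_mul_mul_zero hqC (fun k => (hF k).sub hf.1) hG hb hFf
    have h2 := tendsto_eLpNorm_mul_mul_zero (B := fun _ => f) hqC (fun k => (hG k).sub hg.1)
      (fun _ => hf.1) (M := (eLpNorm f 2 m).toNNReal)
      (Eventually.of_forall fun _ => by rw [ENNReal.coe_toNNReal hf.2.ne]) hGg
    have h3 := h1.add h2
    rw [add_zero] at h3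
    refine tendsto_of_tendsto_of_tendsto_of_le_of_le tendsto_const_nhds h3 (fun _ => zero_le)
      fun k => ?_
    -- Change one factor at a time; Hölder's inequality then makes both pieces small in `L¹`.
    have heq : ((fun x => q x * F k x * G k x) - fun x => q x * f x * g x) =
        (fun x => q x * (F k - f) x * G k x) + fun x => q x * (G k - g) x * f x := by
      ext x; simp only [Pi.sub_apply, Pi.add_apply]; ring
    simp only
    rw [heq]
    exact eLpNorm_add_le ((hq.mul ((hF k).sub hf.1)).mul (hG k))
      ((hq.mul ((hG k).sub hg.1)).mul hf.1) le_rfl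

end L2Limits

variable {n : ℕ} {Ω U : Set (EuclideanSpace ℝ (Fin n))} {σ : Measure (EuclideanSpace ℝ (Fin n))}
  {N : EuclideanSpace ℝ (Fin n) → EuclideanSpace ℝ (Fin n)}

theorem IsGaussGreenPatch.memLp (hP : IsGaussGreenPatch Ω U σ N)
    {f : EuclideanSpace ℝ (Fin n) → ℝ} (hf : MemLp f 2 (surfaceMeasure Ω)) : MemLp f 2 σ := by
  obtain ⟨C, hC⟩ := hP.exists_le_smul
  exact hf.of_measure_le_smul (c := C) ENNReal.coe_ne_top hC

theorem IsGaussGreenPatch.absolutelyContinuous (hP : IsGaussGreenPatch Ω U σ N) :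
    σ ≪ surfaceMeasure Ω := by
  obtain ⟨C, hC⟩ := hP.exists_le_smul
  exact (Measure.absolutelyContinuous_of_le hC).trans (Measure.smul_absolutelyContinuous (c := C))

theorem IsGaussGreenPatch.tendsto_eLpNorm (hP : IsGaussGreenPatch Ω U σ N)
    {F : ℕ → EuclideanSpace ℝ (Fin n) → ℝ}
    (hF : Tendsto (fun k => eLpNorm (F k) 2 (surfaceMeasure Ω)) atTop (𝓝 0)) :
    Tendsto (fun k => eLpNorm (F k) 2 σ) atTop (𝓝 0) := by
  obtain ⟨C, hC⟩ := hP.exists_le_smul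
  have h1 : Tendsto (fun k => (C : ℝ≥0∞) ^ (1 / (2 : ℝ≥0∞)).toReal *
      eLpNorm (F k) 2 (surfaceMeasure Ω)) atTop (𝓝 0) := by
    simpa using ENNReal.Tendsto.const_mul hF
      (Or.inr (ENNReal.rpow_ne_top_of_nonneg (by positivity) (ENNReal.coe_ne_top (r := C))))
  refine tendsto_of_tendsto_of_tendsto_of_le_of_le tendsto_const_nhds h1 (fun _ => zero_le)
    fun k => (eLpNorm_mono_measure _ hC).trans ?_
  exact (eLpNorm_smul_measure_of_ne_top (by norm_num) (F k) (C : ℝ≥0∞)).le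

/-- Integration by parts for functions with traces. -/
theorem IsGaussGreenPatch.integral_by_parts (hP : IsGaussGreenPatch Ω U σ N)
    {f g f₀ g₀ : EuclideanSpace ℝ (Fin n) → ℝ} {Df Dg : Fin n → EuclideanSpace ℝ (Fin n) → ℝ}
    (hf : IsTrace Ω f Df f₀) (hg : IsTrace Ω g Dg g₀)
    {q : EuclideanSpace ℝ (Fin n) → ℝ} (hq : ContDiff ℝ 1 q) (hqc : HasCompactSupport q)
    (hqU : tsupport q ⊆ U) (j : Fin n) :
    (∫ x in Ω, q x * Df j x * g x) + (∫ x in Ω, q x * f x * Dg j x) +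
      (∫ x in Ω, partialDeriv j q x * f x * g x) = ∫ x, q x * N x j * f₀ x * g₀ x ∂σ := by
  obtain ⟨hf1, hf0, φ, hφ, hφf, hφD, hφ0⟩ := hf
  obtain ⟨hg1, hg0, ψ, hψ, hψg, hψD, hψ0⟩ := hg
  have hDq : Continuous (partialDeriv j q) :=
    (hq.continuous_fderiv one_ne_zero).clm_apply continuous_const
  have hDqc : HasCompactSupport (partialDeriv j q) := hqc.fderiv_apply ℝ _
  have hqN : Continuous fun x => q x * N x j :=
    hq.continuous.mul ((EuclideanSpace.proj (𝕜 := ℝ) j).continuous.comp hP.continuous)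
  have hqNc : HasCompactSupport fun x => q x * N x j := hqc.mul_right
  obtain ⟨C1, hC1⟩ := hq.continuous.bounded_above_of_compact_support hqc
  obtain ⟨C2, hC2⟩ := hDq.bounded_above_of_compact_support hDqc
  obtain ⟨C3, hC3⟩ := hqN.bounded_above_of_compact_support hqNc
  have hDφ (k) : Continuous (partialDeriv j (φ k)) :=
    ((hφ k).continuous_fderiv (by simp)).clm_apply continuous_const
  have hDψ (k) : Continuous (partialDeriv j (ψ k)) :=
    ((hψ k).continuous_fderiv (by simp)).clm_apply continuous_const
  have h1 := tendsto_integral_mul_mul hq.continuous.aestronglyMeasurable hC1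
    (fun k => (hDφ k).aestronglyMeasurable) (fun k => (hψ k).continuous.aestronglyMeasurable)
    (hf1.memLp_deriv j) hg1.memLp (hφD j) hψg
  have h2 := tendsto_integral_mul_mul hq.continuous.aestronglyMeasurable hC1
    (fun k => (hφ k).continuous.aestronglyMeasurable) (fun k => (hDψ k).aestronglyMeasurable)
    hf1.memLp (hg1.memLp_deriv j) hφf (hψD j)
  have h3 := tendsto_integral_mul_mul hDq.aestronglyMeasurable hC2
    (fun k => (hφ k).continuous.aestronglyMeasurable)
    (fun k => (hψ k).continuous.aestronglyMeasurable) hf1.memLp hg1.memLp hφf hψg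
  have h4 := tendsto_integral_mul_mul hqN.aestronglyMeasurable hC3
    (fun k => (hφ k).continuous.aestronglyMeasurable)
    (fun k => (hψ k).continuous.aestronglyMeasurable) (hP.memLp hf0) (hP.memLp hg0)
    (hP.tendsto_eLpNorm hφ0) (hP.tendsto_eLpNorm hψ0)
  -- All four integrals are limits of those for the smooth approximations, where the formula is the
  -- divergence theorem for `q * φ k * ψ k`; the factor `q` provides the support in `U`.
  refine tendsto_nhds_unique ((h1.add h2).add h3) (h4.congr fun k => ?_)
  have hφ1 : ContDiff ℝ 1 (φ k) := (hφ k).of_le (by exact_mod_cast le_top)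
  have hψ1 : ContDiff ℝ 1 (ψ k) := (hψ k).of_le (by exact_mod_cast le_top)
  have hG : ContDiff ℝ 1 fun x => q x * φ k x * ψ k x := (hq.mul hφ1).mul hψ1
  have hGc : HasCompactSupport fun x => q x * φ k x * ψ k x := hqc.mul_right.mul_right
  have hGU : (tsupport fun x => q x * φ k x * ψ k x) ⊆ U :=
    ((tsupport_mul_subset_left (f := fun x => q x * φ k x)).trans
      (tsupport_mul_subset_left (f := q))).trans hqU
  have hI {F : EuclideanSpace ℝ (Fin n) → ℝ} (h : Continuous F) (h' : HasCompactSupport F) :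
      IntegrableOn F Ω := (h.integrable_of_hasCompactSupport h').integrableOn
  have hI1 : IntegrableOn (fun x => q x * partialDeriv j (φ k) x * ψ k x) Ω :=
    hI ((hq.continuous.mul (hDφ k)).mul (hψ k).continuous) hqc.mul_right.mul_right
  have hI2 : IntegrableOn (fun x => q x * φ k x * partialDeriv j (ψ k) x) Ω :=
    hI ((hq.continuous.mul (hφ k).continuous).mul (hDψ k)) hqc.mul_right.mul_right
  have hI3 : IntegrableOn (fun x => partialDeriv j q x * φ k x * ψ k x) Ω :=
    hI ((hDq.mul (hφ k).continuous).mul (hψ k).continuous) hDqc.mul_right.mul_right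
  rw [← integral_add hI1 hI2]
  refine Eq.trans ?_ (integral_add (hI1.add hI2) hI3)
  have h5 := hP.integral_fderiv _ hG hGc hGU (EuclideanSpace.single j 1)
  have h6 (y : EuclideanSpace ℝ (Fin n)) : inner ℝ (N y) (EuclideanSpace.single j 1) = N y j := by
    simp [EuclideanSpace.inner_single_right]
  simp_rw [h6] at h5
  have h7 (y : EuclideanSpace ℝ (Fin n)) :
      fderiv ℝ (fun x => q x * φ k x * ψ k x) y (EuclideanSpace.single j 1) =
      q y * partialDeriv j (φ k) y * ψ k y + q y * φ k y * partialDeriv j (ψ k) y +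
        partialDeriv j q y * φ k y * ψ k y := by
    rw [fderiv_fun_mul ((hq.mul hφ1).differentiable one_ne_zero y)
      (hψ1.differentiable one_ne_zero y), fderiv_fun_mul (hq.differentiable one_ne_zero y)
      (hφ1.differentiable one_ne_zero y)]
    simp only [add_apply, smul_apply, smul_eq_mul,
      partialDeriv]
    ring
  simp_rw [h7] at h5
  refine Eq.trans ?_ h5.symm
  refine integral_congr_ae (Eventually.of_forall fun y => ?_)
  simp only
  ring

end

/-! ### Mollification and smooth approximation of the coefficients. -/

noncomputable section

section Mollification

variable {n : ℕ}

/-- Convolution of `f` with the normalized bump function `φ`. -/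
def mollify (φ : ContDiffBump (0 : EuclideanSpace ℝ (Fin n))) (f : EuclideanSpace ℝ (Fin n) → ℝ) :
    EuclideanSpace ℝ (Fin n) → ℝ :=
  convolution (φ.normed volume) f (ContinuousLinearMap.lsmul ℝ ℝ) volume

variable (φ : ContDiffBump (0 : EuclideanSpace ℝ (Fin n))) {f g : EuclideanSpace ℝ (Fin n) → ℝ}

theorem mollify_eq (p : EuclideanSpace ℝ (Fin n)) :
    mollify φ f p = ∫ z, φ.normed volume (p - z) * f z := by
  simp [mollify, convolution_lsmul_swap]

theorem contDiff_mollify (hf : LocallyIntegrable f) : ContDiff ℝ ∞ (mollify φ f) :=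
  φ.hasCompactSupport_normed.contDiff_convolution_left _ (φ.contDiff_normed (n := ⊤)) hf

theorem integrable_normed_sub (p : EuclideanSpace ℝ (Fin n)) :
    Integrable fun z => φ.normed volume (p - z) :=
  φ.integrable_normed.comp_sub_left p

theorem integral_normed_sub (p : EuclideanSpace ℝ (Fin n)) :
    ∫ z, φ.normed volume (p - z) = 1 := by
  rw [integral_sub_left_eq_self (fun z => φ.normed volume z), φ.integral_normed]

theorem integrable_normed_sub_mul (hf : LocallyIntegrable f) (p : EuclideanSpace ℝ (Fin n)) :
    Integrable fun z => φ.normed volume (p - z) * f z := by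
  have h := (φ.hasCompactSupport_normed (μ := volume)).convolutionExists_left (ContinuousLinearMap.lsmul ℝ ℝ)
    φ.continuous_normed hf p
  simpa [ConvolutionExistsAt] using (convolutionExistsAt_iff_integrable_swap
    (L := ContinuousLinearMap.lsmul ℝ ℝ)).1 h

theorem normed_sub_eq_zero {p z : EuclideanSpace ℝ (Fin n)}
    (hz : z ∉ Metric.closedBall p φ.rOut) : φ.normed volume (p - z) = 0 := by
  have : p - z ∉ Function.support (φ.normed volume) := by
    rw [φ.support_normed_eq]
    intro h
    refine hz ?_
    rw [mem_ball_zero_iff] at h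
    rw [Metric.mem_closedBall, dist_comm, dist_eq_norm]
    exact h.le
  simpa using this

theorem abs_mollify_le {K : ℝ} {p : EuclideanSpace ℝ (Fin n)}
    (hf : ∀ᵐ z, z ∈ Metric.closedBall p φ.rOut → |f z| ≤ K) : |mollify φ f p| ≤ K := by
  rw [mollify_eq]
  have h1 : ‖∫ z, φ.normed volume (p - z) * f z‖ ≤ ∫ z, φ.normed volume (p - z) * K := by
    refine norm_integral_le_of_norm_le ((integrable_normed_sub φ p).mul_const K) ?_
    filter_upwards [hf] with z hz
    by_cases hzb : z ∈ Metric.closedBall p φ.rOut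
    · rw [norm_mul, Real.norm_eq_abs, abs_of_nonneg (φ.nonneg_normed _)]
      exact mul_le_mul_of_nonneg_left (hz hzb) (φ.nonneg_normed _)
    · simp [normed_sub_eq_zero φ hzb]
  rwa [integral_mul_const, integral_normed_sub, one_mul] at h1

theorem partialDeriv_mollify (hf : LocallyIntegrable f) (j : Fin n)
    (p : EuclideanSpace ℝ (Fin n)) :
    partialDeriv j (mollify φ f) p = ∫ z, partialDeriv j (φ.normed volume) (p - z) * f z := by
  have hc : Continuous (fderiv ℝ (φ.normed volume)) :=
    (φ.contDiff_normed (n := 1)).continuous_fderiv (by simp)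
  have h := (φ.hasCompactSupport_normed (μ := volume)).hasFDerivAt_convolution_left
    (ContinuousLinearMap.lsmul ℝ ℝ) (φ.contDiff_normed (n := 1)) hf p
  have hex := ((φ.hasCompactSupport_normed (μ := volume)).fderiv ℝ).convolutionExists_left
    (ContinuousLinearMap.precompL (EuclideanSpace ℝ (Fin n)) (ContinuousLinearMap.lsmul ℝ ℝ))
    hc hf p
  rw [partialDeriv, mollify, h.fderiv, convolution_eq_swap,
    ContinuousLinearMap.integral_apply (convolutionExistsAt_iff_integrable_swap.1 hex)]
  simp [ContinuousLinearMap.precompL_apply, partialDeriv]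

/-- The translated kernel is a legitimate test function because its support lies in `Ω`; nearer to
the boundary the extension by zero could contribute a jump. -/
theorem partialDeriv_mollify_indicator {Ω : Set (EuclideanSpace ℝ (Fin n))} (hΩ : IsOpen Ω)
    (hf : IntegrableOn f Ω) {j : Fin n} (hfg : IsWeakPartialDeriv Ω j f g)
    {p : EuclideanSpace ℝ (Fin n)} (hp : Metric.closedBall p φ.rOut ⊆ Ω) :
    partialDeriv j (mollify φ (Ω.indicator f)) p = mollify φ (Ω.indicator g) p := by
  have hloc : LocallyIntegrable (Ω.indicator f) :=
    ((integrable_indicator_iff hΩ.measurableSet).2 hf).locallyIntegrable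
  have hη : ContDiff ℝ ∞ fun z => φ.normed volume (p - z) :=
    (φ.contDiff_normed (n := ⊤)).comp (contDiff_const.sub contDiff_id)
  have hts : tsupport (fun z => φ.normed volume (p - z)) ⊆ Metric.closedBall p φ.rOut :=
    closure_minimal (fun z hz => by
      by_contra h
      exact hz (normed_sub_eq_zero φ h)) Metric.isClosed_closedBall
  have hηc : HasCompactSupport fun z => φ.normed volume (p - z) :=
    HasCompactSupport.of_support_subset_isCompact (isCompact_closedBall p φ.rOut)
      (subset_closure.trans hts)
  have hder (z) : partialDeriv j (fun z => φ.normed volume (p - z)) z =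
      -partialDeriv j (φ.normed volume) (p - z) := by
    have h1 : HasFDerivAt (fun z => p - z)
      (-ContinuousLinearMap.id ℝ (EuclideanSpace ℝ (Fin n))) z := (hasFDerivAt_id z).const_sub p
    have h2 := (((φ.contDiff_normed (μ := volume) (n := 1)).differentiable (by simp)
      (p - z)).hasFDerivAt (𝕜 := ℝ).comp z h1).fderiv
    rw [Function.comp_def] at h2
    rw [partialDeriv, h2]
    simp [partialDeriv]
  have h := hfg.2.2 _ hη hηc (hts.trans hp)
  rw [partialDeriv_mollify φ hloc, mollify_eq]
  have e1 (z) : partialDeriv j (φ.normed volume) (p - z) * Ω.indicator f z =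
      -Ω.indicator (fun z => f z * partialDeriv j (fun z => φ.normed volume (p - z)) z) z := by
    by_cases hz : z ∈ Ω
    · simp only [indicator_of_mem hz, hder]; ring
    · simp [indicator_of_notMem hz]
  have e2 (z) : φ.normed volume (p - z) * Ω.indicator g z =
      Ω.indicator (fun z => g z * φ.normed volume (p - z)) z := by
    by_cases hz : z ∈ Ω
    · simp only [indicator_of_mem hz]; ring
    · simp [indicator_of_notMem hz]
  simp_rw [e1, e2]
  rw [integral_neg, integral_indicator hΩ.measurableSet, integral_indicator hΩ.measurableSet, h,
    neg_neg]

theorem abs_mollify_sub_le {K : ℝ≥0} (hf : LipschitzWith K f) (p : EuclideanSpace ℝ (Fin n)) :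
    |mollify φ f p - f p| ≤ K * φ.rOut := by
  rw [← Real.dist_eq]
  refine φ.dist_normed_convolution_le hf.continuous.aestronglyMeasurable fun x hx => ?_
  refine (hf.dist_le_mul x p).trans ?_
  have := (Metric.mem_ball.1 hx).le
  gcongr

theorem lipschitzWith_mollify {K : ℝ≥0} (hf : LipschitzWith K f) :
    LipschitzWith K (mollify φ f) := by
  refine LipschitzWith.of_dist_le_mul fun p q => ?_
  have hloc : LocallyIntegrable f := hf.continuous.locallyIntegrable
  have h (p) : mollify φ f p = ∫ t, φ.normed volume t * f (p - t) := by
    simp [mollify, convolution_lsmul]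
  have hi (p) : Integrable fun t => φ.normed volume t * f (p - t) := by
    simpa [ConvolutionExistsAt] using φ.hasCompactSupport_normed.convolutionExists_left
      (ContinuousLinearMap.lsmul ℝ ℝ) φ.continuous_normed hloc p
  rw [dist_eq_norm, h, h, ← integral_sub (hi p) (hi q)]
  have h1 : ‖∫ t, (φ.normed volume t * f (p - t) - φ.normed volume t * f (q - t))‖ ≤
      ∫ t, φ.normed volume t * (K * dist p q) := by
    refine norm_integral_le_of_norm_le (φ.integrable_normed.mul_const _)
      (Eventually.of_forall fun t => ?_)
    rw [← mul_sub, norm_mul, Real.norm_eq_abs, abs_of_nonneg (φ.nonneg_normed _)]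
    refine mul_le_mul_of_nonneg_left ?_ (φ.nonneg_normed _)
    rw [← dist_eq_norm]
    simpa using hf.dist_le_mul (p - t) (q - t)
  rwa [integral_mul_const, φ.integral_normed, one_mul] at h1

theorem abs_partialDeriv_le_of_lipschitzWith {K : ℝ≥0} (hf : LipschitzWith K f) (j : Fin n)
    (p : EuclideanSpace ℝ (Fin n)) : |partialDeriv j f p| ≤ K := by
  have h1 := (fderiv ℝ f p).le_opNorm (EuclideanSpace.single j 1)
  have h2 := norm_fderiv_le_of_lipschitz ℝ hf (x₀ := p)
  simp only [PiLp.norm_single, norm_one, mul_one] at h1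
  exact h1.trans h2

end Mollification

/-- Smooth approximation of Lipschitz functions. -/
theorem LipschitzWith.exists_smooth_approx {n : ℕ} {K : ℝ≥0} {f : EuclideanSpace ℝ (Fin n) → ℝ}
    (hf : LipschitzWith K f) : ∃ F : ℕ → EuclideanSpace ℝ (Fin n) → ℝ,
      (∀ k, ContDiff ℝ ∞ (F k)) ∧ (∀ k y, |F k y - f y| ≤ K * (1 / ((k : ℝ) + 1))) ∧
      ∀ k j y, |partialDeriv j (F k) y| ≤ K := by
  let φ (k : ℕ) : ContDiffBump (0 : EuclideanSpace ℝ (Fin n)) :=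
    ⟨1 / ((k : ℝ) + 1) / 2, 1 / ((k : ℝ) + 1), by positivity, half_lt_self (by positivity)⟩
  exact ⟨fun k => mollify (φ k) f, fun k => contDiff_mollify _ hf.continuous.locallyIntegrable,
    fun k y => abs_mollify_sub_le (φ k) hf y,
    fun k j y => abs_partialDeriv_le_of_lipschitzWith (lipschitzWith_mollify (φ k) hf) j y⟩

/-- Small translates of the part of the closure of `Ω` in `U` against the direction `v` stay in
`Ω`, together with proportionally small balls. -/
def HasInwardCone {n : ℕ} (Ω U : Set (EuclideanSpace ℝ (Fin n)))
    (v : EuclideanSpace ℝ (Fin n)) : Prop :=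
  ∃ c δ₀ : ℝ, 0 < c ∧ 0 < δ₀ ∧ ∀ y ∈ U ∩ closure Ω, ∀ δ ∈ Ioo 0 δ₀,
    Metric.closedBall (y - δ • v) (c * δ) ⊆ Ω

theorem ae_abs_le_of_eLpNorm_top_le {n : ℕ} {m : Measure (EuclideanSpace ℝ (Fin n))}
    {f : EuclideanSpace ℝ (Fin n) → ℝ} {K : ℝ≥0} (hf : eLpNorm f ⊤ m ≤ K) :
    ∀ᵐ x ∂m, |f x| ≤ K := by
  filter_upwards [ae_le_eLpNormEssSup (f := f) (μ := m)] with x hx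
  rw [← eLpNorm_exponent_top] at hx
  have h1 := hx.trans hf
  rw [enorm_le_coe] at h1
  exact_mod_cast h1

theorem LInftyBound.ae_abs_le {n : ℕ} {m : Measure (EuclideanSpace ℝ (Fin n))}
    {f : EuclideanSpace ℝ (Fin n) → ℝ} {K : ℝ≥0} (hf : LInftyBound m f K) :
    ∀ᵐ x ∂m, |f x| ≤ K :=
  ae_abs_le_of_eLpNorm_top_le hf.2

/-- Coefficients in `W^{1,∞}` are limits almost everywhere of smooth coefficients satisfying the
same bounds near a piece of the closure. -/
theorem HasInwardCone.exists_smooth_approx {n : ℕ} {Ω U : Set (EuclideanSpace ℝ (Fin n))}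
    {v : EuclideanSpace ℝ (Fin n)} (hcone : HasInwardCone Ω U v) (hΩ : IsOpen Ω)
    (hb : Bornology.IsBounded Ω) {a : Fin n → Fin n → EuclideanSpace ℝ (Fin n) → ℝ} {K : ℝ≥0}
    (ha : ∀ i j, W1InftyBound Ω (a i j) K) {lam : ℝ}
    (hell : ∀ᵐ x ∂(volume.restrict Ω), ∀ ξ : EuclideanSpace ℝ (Fin n),
      lam * ‖ξ‖ ^ 2 ≤ ∑ i, ∑ j, a i j x * ξ i * ξ j) :
    ∃ A : ℕ → Fin n → Fin n → EuclideanSpace ℝ (Fin n) → ℝ,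
      (∀ k i j, ContDiff ℝ ∞ (A k i j)) ∧ (∀ k i j y, |A k i j y| ≤ K) ∧
      (∀ k i j, ∀ y ∈ U ∩ closure Ω, ∀ m, |partialDeriv m (A k i j) y| ≤ K) ∧
      (∀ k, ∀ y ∈ U ∩ closure Ω, ∀ ξ : EuclideanSpace ℝ (Fin n),
        lam * ‖ξ‖ ^ 2 ≤ ∑ i, ∑ j, A k i j y * ξ i * ξ j) ∧
      ∀ i j, ∀ᵐ y, y ∈ Ω → Tendsto (fun k => A k i j y) atTop (𝓝 (a i j y)) := by
  obtain ⟨c, δ₀, hc, hδ₀, hball⟩ := hcone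
  have hΩm := hΩ.measurableSet
  -- Adding `2` keeps the shift strictly below `δ₀` already for `k = 0`.
  let δ (k : ℕ) : ℝ := δ₀ / ((k : ℝ) + 2)
  have hδpos (k) : 0 < δ k := by positivity
  have hδ (k) : δ k ∈ Ioo 0 δ₀ := ⟨hδpos k, by
    rw [div_lt_iff₀ (by positivity)]; nlinarith [(Nat.cast_nonneg k : (0 : ℝ) ≤ k)]⟩
  have hδ0 : Tendsto δ atTop (𝓝 0) :=
    tendsto_const_nhds.div_atTop (tendsto_atTop_add_const_right _ _ tendsto_natCast_atTop_atTop)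
  let φ (k : ℕ) : ContDiffBump (0 : EuclideanSpace ℝ (Fin n)) :=
    ⟨c * δ k / 2, c * δ k, by have := hδpos k; positivity,
      half_lt_self (by have := hδpos k; positivity)⟩
  have hvol : volume Ω ≠ ⊤ := hb.measure_lt_top.ne
  have : IsFiniteMeasure (volume.restrict Ω) := ⟨by simpa using hvol.lt_top⟩
  have hbd (i j) : ∀ᵐ z, z ∈ Ω → |a i j z| ≤ K :=
    (ae_restrict_iff' hΩm).1 (ha i j).1.ae_abs_le
  have hint (i j) : IntegrableOn (a i j) Ω :=
    Integrable.of_bound (ha i j).1.1 K (ha i j).1.ae_abs_le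
  have hloc (i j) : LocallyIntegrable (Ω.indicator (a i j)) :=
    ((integrable_indicator_iff hΩm).2 (hint i j)).locallyIntegrable
  have hindbd {f : EuclideanSpace ℝ (Fin n) → ℝ} (hf : ∀ᵐ z, z ∈ Ω → |f z| ≤ K) :
      ∀ᵐ z, |Ω.indicator f z| ≤ K := by
    filter_upwards [hf] with z hz
    by_cases hzΩ : z ∈ Ω
    · simpa [hzΩ] using hz hzΩ
    · simp [hzΩ]
  have hin (k) (y) (hy : y ∈ U ∩ closure Ω) : Metric.closedBall (y - δ k • v) (φ k).rOut ⊆ Ω :=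
    hball y hy (δ k) (hδ k)
  -- The kernel is centred at an inward translate, so even at a boundary point it averages over a
  -- ball inside `Ω`. Averages inherit the bounds on the coefficients and on their weak derivatives,
  -- and the ellipticity.
  refine ⟨fun k i j y => mollify (φ k) (Ω.indicator (a i j)) (y - δ k • v), ?_, ?_, ?_, ?_, ?_⟩
  · exact fun k i j => (contDiff_mollify (φ k) (hloc i j)).comp (contDiff_id.sub contDiff_const)
  · intro k i j y
    refine abs_mollify_le (φ k) ?_
    filter_upwards [hindbd (hbd i j)] with z hz _ using hz
  · intro k i j y hy m
    obtain ⟨g, hg, hgK⟩ := (ha i j).2 m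
    have h1 : partialDeriv m (fun y => mollify (φ k) (Ω.indicator (a i j)) (y - δ k • v)) y =
        partialDeriv m (mollify (φ k) (Ω.indicator (a i j))) (y - δ k • v) := by
      simp only [partialDeriv, sub_eq_add_neg]
      rw [fderiv_comp_add_right (f := mollify (φ k) (Ω.indicator (a i j)))]
    rw [h1, partialDeriv_mollify_indicator (φ k) hΩ (hint i j) hg (hin k y hy)]
    refine abs_mollify_le (φ k) ?_
    filter_upwards [hindbd ((ae_restrict_iff' hΩm).1 hgK.ae_abs_le)] with z hz _ using hz
  · intro k y hy ξ
    set p := y - δ k • v with hp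
    have hI (i j) := integrable_normed_sub_mul (φ k) (hloc i j) p
    have h1 : ∑ i, ∑ j, mollify (φ k) (Ω.indicator (a i j)) p * ξ i * ξ j =
        ∫ z, (φ k).normed volume (p - z) * ∑ i, ∑ j, Ω.indicator (a i j) z * ξ i * ξ j := by
      simp_rw [mollify_eq, Finset.mul_sum, ← integral_mul_const]
      rw [integral_finsetSum _ fun i _ => integrable_finsetSum _ fun j _ => by
        simpa only [mul_assoc] using ((hI i j).mul_const (ξ i)).mul_const (ξ j)]
      refine Finset.sum_congr rfl fun i _ => ?_
      rw [integral_finsetSum _ fun j _ => by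
        simpa only [mul_assoc] using ((hI i j).mul_const (ξ i)).mul_const (ξ j)]
      simp only [mul_assoc]
    have h2 : lam * ‖ξ‖ ^ 2 = ∫ z, (φ k).normed volume (p - z) * (lam * ‖ξ‖ ^ 2) := by
      rw [integral_mul_const, integral_normed_sub, one_mul]
    rw [h1, h2]
    refine integral_mono_ae ((integrable_normed_sub (φ k) p).mul_const _) ?_ ?_
    · simp_rw [Finset.mul_sum]
      exact integrable_finsetSum _ fun i _ => integrable_finsetSum _ fun j _ => by
        simpa only [mul_assoc] using ((hI i j).mul_const (ξ i)).mul_const (ξ j)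
    · filter_upwards [(ae_restrict_iff' hΩm).1 hell] with z hz
      by_cases hzb : z ∈ Metric.closedBall p (φ k).rOut
      · have hzΩ := hin k y hy hzb
        simp only [indicator_of_mem hzΩ]
        exact mul_le_mul_of_nonneg_left (hz hzΩ ξ) ((φ k).nonneg_normed _)
      · simp [normed_sub_eq_zero (φ k) hzb]
  · intro i j
    -- Lebesgue differentiation with off-centre balls: the centre is at distance `δ k * ‖v‖`, which
    -- is `‖v‖ / c` times the radius `c * δ k`.
    filter_upwards [IsUnifLocDoublingMeasure.ae_tendsto_average_norm_sub volume (hloc i j)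
      (‖v‖ / c)] with y hy hyΩ
    have hrad : Tendsto (fun k => c * δ k) atTop (𝓝[>] 0) := by
      refine tendsto_nhdsWithin_iff.2 ⟨by simpa using hδ0.const_mul c, Eventually.of_forall
        fun k => ?_⟩
      have := hδpos k
      exact mul_pos hc this
    have h1 := hy (fun k => y - δ k • v) (fun k => c * δ k) hrad (Eventually.of_forall fun k => by
      rw [Metric.mem_closedBall, dist_eq_norm, sub_sub_cancel, norm_smul, Real.norm_eq_abs,
        abs_of_pos (hδpos k)]
      refine le_of_eq ?_
      field_simp)
    -- The outer radius of the bump is twice the inner one, so the kernel is at most `2 ^ n` divided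
    -- by the volume of the outer ball.
    have h2 := tendsto_integral_smul_of_tendsto_average_norm_sub
      (g := fun k z => (φ k).normed volume (y - δ k • v - z))
      (2 ^ Module.finrank ℝ (EuclideanSpace ℝ (Fin n))) h1
      (Eventually.of_forall fun k => (hloc i j).integrableOn_isCompact (isCompact_closedBall _ _))
      (by simp_rw [integral_normed_sub]; exact tendsto_const_nhds)
      (Eventually.of_forall fun k z hz => by
        by_contra h
        exact hz (normed_sub_eq_zero (φ k) h))
      (Eventually.of_forall fun k z => by
        rw [abs_of_nonneg ((φ k).nonneg_normed _), Measure.addHaar_real_closedBall_center]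
        exact (φ k).normed_le_div_measure_closedBall_rOut _ _ (by simp only [φ]; linarith) _)
    rw [indicator_of_mem hyΩ] at h2
    simpa [mollify_eq] using h2

end

/-! ### Energy estimate on a patch. -/

section

/-- `u` belongs to `H²(Ω)`, and `u₀` and `Du₀` are the traces of `u` and of its gradient. -/
structure IsH2WithTraces {n : ℕ} (Ω : Set (EuclideanSpace ℝ (Fin n)))
    (u : EuclideanSpace ℝ (Fin n) → ℝ) (Du : Fin n → EuclideanSpace ℝ (Fin n) → ℝ)
    (D2u : Fin n → Fin n → EuclideanSpace ℝ (Fin n) → ℝ)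
    (u₀ : EuclideanSpace ℝ (Fin n) → ℝ) (Du₀ : Fin n → EuclideanSpace ℝ (Fin n) → ℝ) : Prop where
  isH2 : IsH2 Ω u Du D2u
  trace : IsTrace Ω u Du u₀
  trace_deriv : ∀ i, IsTrace Ω (Du i) (D2u i) (Du₀ i)

variable {n : ℕ} {Ω U : Set (EuclideanSpace ℝ (Fin n))} {σ : Measure (EuclideanSpace ℝ (Fin n))}
  {N : EuclideanSpace ℝ (Fin n) → EuclideanSpace ℝ (Fin n)}
  {u u₀ : EuclideanSpace ℝ (Fin n) → ℝ} {Du Du₀ : Fin n → EuclideanSpace ℝ (Fin n) → ℝ}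
  {D2u : Fin n → Fin n → EuclideanSpace ℝ (Fin n) → ℝ}

theorem partialDeriv_comm {φ : EuclideanSpace ℝ (Fin n) → ℝ} (hφ : ContDiff ℝ ∞ φ) (i j : Fin n)
    (x : EuclideanSpace ℝ (Fin n)) :
    partialDeriv i (partialDeriv j φ) x = partialDeriv j (partialDeriv i φ) x := by
  have hD : Differentiable ℝ (fderiv ℝ φ) :=
    ((contDiff_infty.1 hφ 2).fderiv_right (m := 1) (by norm_num)).differentiable (by simp)
  have h (i j : Fin n) : partialDeriv i (partialDeriv j φ) x =
      fderiv ℝ (fderiv ℝ φ) x (EuclideanSpace.single i 1) (EuclideanSpace.single j 1) := by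
    have h1 := (hD x).hasFDerivAt.clm_apply
      (hasFDerivAt_const (EuclideanSpace.single j (1 : ℝ)) x)
    have h2 : partialDeriv j φ = fun y => fderiv ℝ φ y (EuclideanSpace.single j 1) := rfl
    rw [partialDeriv, h2, h1.fderiv]
    simp
  rw [h, h]
  exact ((contDiff_infty.1 hφ 2).contDiffAt.isSymmSndFDerivAt (by simp)).eq _ _

theorem contDiff_partialDeriv {φ : EuclideanSpace ℝ (Fin n) → ℝ} (hφ : ContDiff ℝ ∞ φ)
    (i : Fin n) : ContDiff ℝ ∞ (partialDeriv i φ) :=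
  (hφ.fderiv_right (m := ∞) (by simp)).clm_apply contDiff_const

/-- The weak Hessian is symmetric. -/
theorem IsH2.hessian_symm (hΩ : IsOpen Ω) (hu : IsH2 Ω u Du D2u) (i j : Fin n) :
    ∀ᵐ x ∂(volume.restrict Ω), D2u i j x = D2u j i x := by
  have hw (i j : Fin n) := (hu.isH1_deriv i).weakDeriv j
  have hloc : LocallyIntegrableOn (fun x => D2u i j x - D2u j i x) Ω :=
    (hw i j).2.1.sub (hw j i).2.1
  have key := hΩ.ae_eq_zero_of_integral_contDiff_smul_eq_zero (μ := volume) hloc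
  have hint {f : EuclideanSpace ℝ (Fin n) → ℝ} (hf : LocallyIntegrableOn f Ω)
      {φ : EuclideanSpace ℝ (Fin n) → ℝ} (hφ : Continuous φ) (hc : HasCompactSupport φ)
      (hs : tsupport φ ⊆ Ω) : IntegrableOn (fun x => f x * φ x) Ω := by
    have h1 : IntegrableOn (fun x => f x * φ x) (tsupport φ) :=
      (hf.integrableOn_compact_subset hs hc).mul_continuousOn hφ.continuousOn hc
    refine Integrable.integrableOn ?_
    refine (integrableOn_iff_integrable_of_support_subset ?_).1 h1
    exact (Function.support_mul_subset_right f φ).trans (subset_tsupport φ)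
  rw [ae_restrict_iff' hΩ.measurableSet]
  have h0 := key fun φ hφ hc hs => by
    -- Both weak derivatives are moved to the test function, whose mixed partial derivatives
    -- commute.
    have h1 (i j : Fin n) : ∫ x in Ω, D2u i j x * φ x =
        ∫ x in Ω, u x * partialDeriv i (partialDeriv j φ) x := by
      have e1 := (hw i j).2.2 φ hφ hc hs
      have e2 := (hu.isH1.weakDeriv i).2.2 _ (contDiff_partialDeriv hφ j) (hc.fderiv_apply ℝ _)
        ((tsupport_fderiv_apply_subset ℝ _).trans hs)
      linarith
    have h2 : ∫ x in Ω, (D2u i j x * φ x - D2u j i x * φ x) = 0 := by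
      rw [integral_sub (hint (hw i j).2.1 hφ.continuous hc hs)
        (hint (hw j i).2.1 hφ.continuous hc hs), h1, h1]
      simp_rw [partialDeriv_comm hφ i j]
      exact sub_self _
    rw [← h2]
    rw [← setIntegral_eq_integral_of_forall_compl_eq_zero (s := Ω) fun x hx => ?_]
    · refine integral_congr_ae (Eventually.of_forall fun x => ?_)
      simp only [smul_eq_mul]
      ring
    · rw [image_eq_zero_of_notMem_tsupport fun h => hx (hs h), zero_smul]
  filter_upwards [h0] with x hx hxΩ
  exact sub_eq_zero.1 (hx hxΩ)

/-- A contraction with a symmetric matrix sees only the symmetric part. Hence `q` may be modified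
antisymmetrically to adjust the boundary term. -/
theorem sum_mul_eq_of_symm {q A S : Fin n → Fin n → ℝ} {z : ℝ}
    (hq : ∀ i j, q i j + q j i = z * (A i j + A j i)) (hS : ∀ i j, S i j = S j i) :
    ∑ i, ∑ j, q i j * S i j = z * ∑ i, ∑ j, A i j * S i j := by
  have h1 (B : Fin n → Fin n → ℝ) : ∑ i, ∑ j, B i j * S i j = ∑ i, ∑ j, B j i * S i j := by
    rw [Finset.sum_comm]
    exact Finset.sum_congr rfl fun i _ => Finset.sum_congr rfl fun j _ => by rw [hS i j]
  have h2 : ∑ i, ∑ j, (q i j + q j i) * S i j = ∑ i, ∑ j, z * (A i j + A j i) * S i j :=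
    Finset.sum_congr rfl fun i _ => Finset.sum_congr rfl fun j _ => by rw [hq]
  simp only [add_mul, mul_add, Finset.sum_add_distrib, mul_assoc, ← Finset.mul_sum] at h2
  rw [← h1 q, ← h1 A] at h2
  linarith

/-- By symmetry of the Hessian, `q` replaces `ζ A`, and integration by parts yields three terms
besides: `q_ij u_i u_j`, bounded below by ellipticity; `∂_j q_ij u_i u`, where the free index `j`
costs the factor `n`; and the boundary term, whose upper bound `w` is left to the application. -/
theorem IsGaussGreenPatch.integral_hessian_add_le (hP : IsGaussGreenPatch Ω U σ N)
    (hΩ : IsOpen Ω) (hu : IsH2WithTraces Ω u Du D2u u₀ Du₀)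
    {q A : Fin n → Fin n → EuclideanSpace ℝ (Fin n) → ℝ} {ζ : EuclideanSpace ℝ (Fin n) → ℝ}
    (hζ : Continuous ζ) (hζc : HasCompactSupport ζ)
    (hq : ∀ i j, ContDiff ℝ 1 (q i j)) (hqc : ∀ i j, HasCompactSupport (q i j))
    (hqU : ∀ i j, tsupport (q i j) ⊆ U)
    (hsym : ∀ y ∈ Ω, ∀ i j, q i j y + q j i y = ζ y * (A i j y + A j i y)) {lam C : ℝ}
    (hell : ∀ y ∈ Ω, ∀ ξ : EuclideanSpace ℝ (Fin n),
      lam * (ζ y * ‖ξ‖ ^ 2) ≤ ∑ i, ∑ j, q i j y * ξ i * ξ j)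
    (hC : ∀ y ∈ Ω, ∀ i j, |partialDeriv j (q i j) y| ≤ C)
    {w : EuclideanSpace ℝ (Fin n) → ℝ} (hw : Integrable w σ)
    (hqw : ∀ᵐ y ∂σ, ∑ i, ∑ j, q i j y * N y j * Du₀ i y * u₀ y ≤ w y) :
    (∫ x in Ω, ζ x * (∑ i, ∑ j, A i j x * D2u i j x) * u x) +
      lam * (∫ x in Ω, ζ x * ∑ i, Du i x ^ 2) ≤
    n * C * (∫ x in Ω, (∑ i, |Du i x|) * |u x|) + ∫ y, w y ∂σ := by
  have hu2 := hu.trace.1.memLp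
  have hDu2 (i) := hu.trace.1.memLp_deriv i
  have hD2u2 (i j) := (hu.trace_deriv i).1.memLp_deriv j
  have hDq (i j) : Continuous (partialDeriv j (q i j)) :=
    ((hq i j).continuous_fderiv one_ne_zero).clm_apply continuous_const
  have hDqc (i j) : HasCompactSupport (partialDeriv j (q i j)) := (hqc i j).fderiv_apply ℝ _
  have hI {m : Measure (EuclideanSpace ℝ (Fin n))} {p f g : EuclideanSpace ℝ (Fin n) → ℝ}
      (hp : Continuous p) (hpc : HasCompactSupport p) (hf : MemLp f 2 m) (hg : MemLp g 2 m) :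
      Integrable (fun x => p x * f x * g x) m := by
    obtain ⟨M, hM⟩ := hp.bounded_above_of_compact_support hpc
    exact integrable_bdd_mul_mul hp.aestronglyMeasurable (Eventually.of_forall hM) hf hg
  have i1 (i j) := hI (hq i j).continuous (hqc i j) (hD2u2 i j) hu2
  have i2 (i j) := hI (hq i j).continuous (hqc i j) (hDu2 i) (hDu2 j)
  have i3 (i j) := hI (hDq i j) (hDqc i j) (hDu2 i) hu2
  have hqN (i j) : Continuous fun x => q i j x * N x j :=
    (hq i j).continuous.mul ((EuclideanSpace.proj (𝕜 := ℝ) j).continuous.comp hP.continuous)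
  have i4 (i j) := hI (hqN i j) (hqc i j).mul_right (hP.memLp (hu.trace_deriv i).2.1)
    (hP.memLp hu.trace.2.1)
  have hsum {m : Measure (EuclideanSpace ℝ (Fin n))}
      {f : Fin n → Fin n → EuclideanSpace ℝ (Fin n) → ℝ} (hf : ∀ i j, Integrable (f i j) m) :
      ∑ i, ∑ j, ∫ x, f i j x ∂m = ∫ x, ∑ i, ∑ j, f i j x ∂m := by
    rw [integral_finsetSum _ fun i _ => integrable_finsetSum _ fun j _ => hf i j]
    exact Finset.sum_congr rfl fun i _ => (integral_finsetSum _ fun j _ => hf i j).symm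
  have hsumI {m : Measure (EuclideanSpace ℝ (Fin n))}
      {f : Fin n → Fin n → EuclideanSpace ℝ (Fin n) → ℝ} (hf : ∀ i j, Integrable (f i j) m) :
      Integrable (fun x => ∑ i, ∑ j, f i j x) m :=
    integrable_finsetSum _ fun i _ => integrable_finsetSum _ fun j _ => hf i j
  have hid : (∫ x in Ω, ∑ i, ∑ j, q i j x * D2u i j x * u x) +
      (∫ x in Ω, ∑ i, ∑ j, q i j x * Du i x * Du j x) +
      (∫ x in Ω, ∑ i, ∑ j, partialDeriv j (q i j) x * Du i x * u x) =
      ∫ x, ∑ i, ∑ j, q i j x * N x j * Du₀ i x * u₀ x ∂σ := by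
    rw [← hsum i1, ← hsum i2, ← hsum i3, ← hsum i4]
    simp only [← Finset.sum_add_distrib]
    exact Finset.sum_congr rfl fun i _ => Finset.sum_congr rfl fun j _ =>
      hP.integral_by_parts (hu.trace_deriv i) hu.trace (hq i j) (hqc i j) (hqU i j) j
  have e1 : ∫ x in Ω, ζ x * (∑ i, ∑ j, A i j x * D2u i j x) * u x =
      ∫ x in Ω, ∑ i, ∑ j, q i j x * D2u i j x * u x := by
    refine integral_congr_ae ?_
    have hs : ∀ᵐ x ∂(volume.restrict Ω), ∀ i j, D2u i j x = D2u j i x :=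
      ae_all_iff.2 fun i => ae_all_iff.2 fun j => hu.isH2.hessian_symm hΩ i j
    filter_upwards [hs, ae_restrict_mem hΩ.measurableSet] with x hx hxΩ
    rw [← sum_mul_eq_of_symm (hsym x hxΩ) hx, Finset.sum_mul]
    exact Finset.sum_congr rfl fun i _ => Finset.sum_mul _ _ _
  have e2 : lam * (∫ x in Ω, ζ x * ∑ i, Du i x ^ 2) ≤
      ∫ x in Ω, ∑ i, ∑ j, q i j x * Du i x * Du j x := by
    rw [← integral_const_mul]
    refine integral_mono_ae ?_ (hsumI i2) ?_
    · refine Integrable.const_mul ?_ lam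
      simp_rw [Finset.mul_sum]
      refine integrable_finsetSum _ fun i _ => ?_
      simpa only [pow_two, mul_assoc] using hI hζ hζc (hDu2 i) (hDu2 i)
    · filter_upwards [ae_restrict_mem hΩ.measurableSet] with x hxΩ
      have := hell x hxΩ (WithLp.toLp 2 fun i => Du i x)
      simpa [EuclideanSpace.norm_sq_eq] using this
  have i5 : Integrable (fun x => (∑ i, |Du i x|) * |u x|) (volume.restrict Ω) := by
    simp_rw [Finset.sum_mul]
    exact integrable_finsetSum _ fun i _ => ((hDu2 i).abs).integrable_mul hu2.abs
  have e3 : -(n * C * (∫ x in Ω, (∑ i, |Du i x|) * |u x|)) ≤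
      ∫ x in Ω, ∑ i, ∑ j, partialDeriv j (q i j) x * Du i x * u x := by
    rw [← integral_const_mul, ← integral_neg]
    refine integral_mono_ae (i5.const_mul _).neg (hsumI i3) ?_
    filter_upwards [ae_restrict_mem hΩ.measurableSet] with x hxΩ
    have h1 (i j : Fin n) : -(C * |Du i x| * |u x|) ≤ partialDeriv j (q i j) x * Du i x * u x := by
      refine (neg_le_neg ?_).trans (neg_abs_le _)
      rw [abs_mul, abs_mul]
      gcongr
      exact hC x hxΩ i j
    refine le_trans (le_of_eq ?_) (Finset.sum_le_sum fun i _ => Finset.sum_le_sum fun j _ => h1 i j)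
    simp only [Finset.sum_neg_distrib, Finset.sum_const, Finset.card_univ, Fintype.card_fin,
      nsmul_eq_mul, Finset.mul_sum, Finset.sum_mul]
    congr 1
    exact Finset.sum_congr rfl fun i _ => by ring
  have e4 := integral_mono_ae (hsumI i4) hw hqw
  rw [e1]
  linarith

/-- Trace inequality on a patch where some direction `v` is transversal to the boundary. -/
theorem IsGaussGreenPatch.integral_trace_sq_le (hP : IsGaussGreenPatch Ω U σ N)
    (hu : IsTrace Ω u Du u₀) {ζ : EuclideanSpace ℝ (Fin n) → ℝ} (hζ : ContDiff ℝ 1 ζ)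
    (hζc : HasCompactSupport ζ) (hζU : tsupport ζ ⊆ U) {Z : ℝ} (hZ : ∀ y, |ζ y| ≤ Z)
    (hZ' : ∀ j y, |partialDeriv j ζ y| ≤ Z) {v : EuclideanSpace ℝ (Fin n)} (hv : ‖v‖ ≤ 1)
    (hvN : ∀ᵐ y ∂σ, ζ y ≤ ζ y * inner ℝ (N y) v) :
    ∫ y, ζ y * u₀ y ^ 2 ∂σ ≤
      2 * Z * (∫ x in Ω, (∑ i, |Du i x|) * |u x|) + n * Z * ∫ x in Ω, u x ^ 2 := by
  have hu2 := hu.1.memLp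
  have hDu2 (i) := hu.1.memLp_deriv i
  have hZ0 : 0 ≤ Z := (abs_nonneg _).trans (hZ 0)
  have hDζ (j) : Continuous (partialDeriv j ζ) :=
    (hζ.continuous_fderiv one_ne_zero).clm_apply continuous_const
  have hvj (j : Fin n) : |v j| ≤ 1 := by
    have := PiLp.norm_apply_le v j
    exact this.trans hv
  have hζN (j) : Continuous fun x => ζ x * N x j :=
    hζ.continuous.mul ((EuclideanSpace.proj (𝕜 := ℝ) j).continuous.comp hP.continuous)
  have hu02 := hP.memLp hu.2.1
  have i4 (j : Fin n) : Integrable (fun y => ζ y * N y j * u₀ y * u₀ y) σ := by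
    obtain ⟨M, hM⟩ := (hζN j).bounded_above_of_compact_support hζc.mul_right
    exact integrable_bdd_mul_mul (hζN j).aestronglyMeasurable (Eventually.of_forall hM) hu02 hu02
  have i5 (j : Fin n) : Integrable (fun x => |Du j x| * |u x|) (volume.restrict Ω) :=
    ((hDu2 j).abs).integrable_mul hu2.abs
  have i6 : Integrable (fun x => u x ^ 2) (volume.restrict Ω) := hu2.integrable_sq
  have hj (j : Fin n) : v j * (∫ y, ζ y * N y j * u₀ y * u₀ y ∂σ) ≤
      2 * Z * (∫ x in Ω, |Du j x| * |u x|) + Z * ∫ x in Ω, u x ^ 2 := by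
    rw [← hP.integral_by_parts hu hu hζ hζc hζU j]
    have b1 : |∫ x in Ω, ζ x * Du j x * u x| ≤ Z * ∫ x in Ω, |Du j x| * |u x| := by
      rw [← integral_const_mul, ← Real.norm_eq_abs]
      refine norm_integral_le_of_norm_le ((i5 j).const_mul Z) (Eventually.of_forall fun x => ?_)
      rw [Real.norm_eq_abs, abs_mul, abs_mul, mul_assoc]
      exact mul_le_mul_of_nonneg_right (hZ x) (by positivity)
    have b2 : |∫ x in Ω, ζ x * u x * Du j x| ≤ Z * ∫ x in Ω, |Du j x| * |u x| := by
      convert b1 using 4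
      ring
    have b3 : |∫ x in Ω, partialDeriv j ζ x * u x * u x| ≤ Z * ∫ x in Ω, u x ^ 2 := by
      rw [← integral_const_mul, ← Real.norm_eq_abs]
      refine norm_integral_le_of_norm_le (i6.const_mul Z) (Eventually.of_forall fun x => ?_)
      rw [Real.norm_eq_abs, abs_mul, abs_mul, mul_assoc, ← pow_two, sq_abs]
      exact mul_le_mul_of_nonneg_right (hZ' j x) (by positivity)
    refine (le_abs_self _).trans ?_
    rw [abs_mul]
    refine (mul_le_of_le_one_left (abs_nonneg _) (hvj j)).trans ?_
    refine (abs_add_le _ _).trans ?_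
    have := abs_add_le (∫ x in Ω, ζ x * Du j x * u x) (∫ x in Ω, ζ x * u x * Du j x)
    linarith
  -- Weighting the formula for `u * u` in direction `j` by `v j` and summing gives the boundary
  -- density `ζ * ⟪N, v⟫ * u₀²`, which dominates `ζ * u₀²`.
  have hsum : ∫ y, ζ y * u₀ y ^ 2 ∂σ ≤ ∑ j, v j * (∫ y, ζ y * N y j * u₀ y * u₀ y ∂σ) := by
    simp_rw [← integral_const_mul]
    rw [← integral_finsetSum _ fun j _ => (i4 j).const_mul _]
    refine integral_mono_ae ?_ (integrable_finsetSum _ fun j _ => (i4 j).const_mul _) ?_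
    · have := integrable_bdd_mul_mul hζ.continuous.aestronglyMeasurable
        (Eventually.of_forall hZ) hu02 hu02
      simpa only [pow_two, mul_assoc] using this
    · filter_upwards [hvN] with y hy
      have h1 : ∑ j, v j * (ζ y * N y j * u₀ y * u₀ y) = ζ y * inner ℝ (N y) v * u₀ y ^ 2 := by
        rw [PiLp.inner_apply, Finset.mul_sum, Finset.sum_mul]
        exact Finset.sum_congr rfl fun j _ => by simp; ring
      rw [h1]
      exact mul_le_mul_of_nonneg_right hy (sq_nonneg _)
  refine hsum.trans ((Finset.sum_le_sum fun j _ => hj j).trans (le_of_eq ?_))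
  simp_rw [Finset.sum_mul]
  rw [integral_finsetSum _ fun j _ => i5 j, Finset.sum_add_distrib, ← Finset.mul_sum]
  simp [mul_assoc]

/-- Energy estimate on a patch, for coefficients that are limits of smooth coefficients whose
conormal derivative is a multiple of the oblique derivative. -/
theorem IsGaussGreenPatch.energy_estimate (hP : IsGaussGreenPatch Ω U σ N)
    (hΩ : IsOpen Ω) (hu : IsH2WithTraces Ω u Du D2u u₀ Du₀)
    {ζ : EuclideanSpace ℝ (Fin n) → ℝ} (hζ : ContDiff ℝ 1 ζ)
    (hζc : HasCompactSupport ζ) (hζU : tsupport ζ ⊆ U) {Z : ℝ} (hZ : ∀ y, |ζ y| ≤ Z)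
    (hZ' : ∀ j y, |partialDeriv j ζ y| ≤ Z) {v : EuclideanSpace ℝ (Fin n)} (hv : ‖v‖ ≤ 1)
    (hvN : ∀ᵐ y ∂σ, ζ y ≤ ζ y * inner ℝ (N y) v)
    {β : Fin n → EuclideanSpace ℝ (Fin n) → ℝ} {l : EuclideanSpace ℝ (Fin n) → ℝ} {Kl : ℝ≥0}
    (hbc : ∀ᵐ x ∂(surfaceMeasure Ω), ∑ i, β i x * Du₀ i x + l x * u₀ x = 0)
    (hl : ∀ᵐ x ∂(surfaceMeasure Ω), -l x ≤ Kl)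
    {a : Fin n → Fin n → EuclideanSpace ℝ (Fin n) → ℝ}
    {A q : ℕ → Fin n → Fin n → EuclideanSpace ℝ (Fin n) → ℝ} {Ca : ℝ}
    (hA : ∀ k i j, Continuous (A k i j)) (hACa : ∀ k i j y, |A k i j y| ≤ Ca)
    (hAa : ∀ i j, ∀ᵐ y, y ∈ Ω → Tendsto (fun k => A k i j y) atTop (𝓝 (a i j y)))
    (hq : ∀ k i j, ContDiff ℝ 1 (q k i j)) (hqc : ∀ k i j, HasCompactSupport (q k i j))
    (hqU : ∀ k i j, tsupport (q k i j) ⊆ U)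
    (hsym : ∀ k, ∀ y ∈ Ω, ∀ i j, q k i j y + q k j i y = ζ y * (A k i j y + A k j i y))
    {lam C C₁ : ℝ} (hC₁ : 0 ≤ C₁)
    (hell : ∀ k, ∀ y ∈ Ω, ∀ ξ : EuclideanSpace ℝ (Fin n),
      lam * (ζ y * ‖ξ‖ ^ 2) ≤ ∑ i, ∑ j, q k i j y * ξ i * ξ j)
    (hC : ∀ k, ∀ y ∈ Ω, ∀ i j, |partialDeriv j (q k i j) y| ≤ C)
    {b : ℕ → Fin n → EuclideanSpace ℝ (Fin n) → ℝ} {s : ℕ → EuclideanSpace ℝ (Fin n) → ℝ}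
    (hqN : ∀ k, ∀ᵐ y ∂σ, ∀ i, ∑ j, q k i j y * N y j = ζ y * s k y * b k i y)
    (hs : ∀ k, ∀ᵐ y ∂σ, 0 ≤ ζ y * s k y ∧ ζ y * s k y ≤ C₁ * ζ y) {ε : ℕ → ℝ}
    (hε : Tendsto ε atTop (𝓝 0)) (hb : ∀ k, ∀ᵐ y ∂σ, ∀ i, |b k i y - β i y| ≤ ε k) :
    (∫ x in Ω, ζ x * (∑ i, ∑ j, a i j x * D2u i j x) * u x) +
      lam * (∫ x in Ω, ζ x * ∑ i, Du i x ^ 2) ≤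
    (n * C + C₁ * Kl * (2 * Z)) * (∫ x in Ω, (∑ i, |Du i x|) * |u x|) +
      C₁ * Kl * (n * Z) * ∫ x in Ω, u x ^ 2 := by
  have hu2 := hu.trace.1.memLp
  have hD2u2 (i j) := (hu.trace_deriv i).1.memLp_deriv j
  have hu02 := hP.memLp hu.trace.2.1
  have hDu02 (i) := hP.memLp (hu.trace_deriv i).2.1
  have hZ0 : 0 ≤ Z := (abs_nonneg _).trans (hZ 0)
  have hCa0 (i : Fin n) : 0 ≤ Ca := (abs_nonneg _).trans (hACa 0 i i 0)
  have hσ := hP.absolutelyContinuous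
  have j1 : Integrable (fun y => ζ y * u₀ y ^ 2) σ := by
    have := integrable_bdd_mul_mul hζ.continuous.aestronglyMeasurable
      (Eventually.of_forall hZ) hu02 hu02
    simpa only [pow_two, mul_assoc] using this
  have j2 : Integrable (fun y => ζ y * ((∑ i, |Du₀ i y|) * |u₀ y|)) σ := by
    simp_rw [Finset.sum_mul, Finset.mul_sum]
    refine integrable_finsetSum _ fun i _ => ?_
    have := integrable_bdd_mul_mul hζ.continuous.aestronglyMeasurable
      (Eventually.of_forall hZ) (hDu02 i).abs hu02.abs
    simpa only [Pi.abs_apply, mul_assoc] using this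
  set T := ∫ y, ζ y * u₀ y ^ 2 ∂σ with hT
  set W := ∫ y, ζ y * ((∑ i, |Du₀ i y|) * |u₀ y|) ∂σ with hW
  set P := ∫ x in Ω, (∑ i, |Du i x|) * |u x| with hPdef
  set R := ∫ x in Ω, u x ^ 2 with hR
  set Q := ∫ x in Ω, ζ x * ∑ i, Du i x ^ 2 with hQ
  have hk (k : ℕ) : (∫ x in Ω, ζ x * (∑ i, ∑ j, A k i j x * D2u i j x) * u x) + lam * Q ≤
      n * C * P + (C₁ * Kl * T + C₁ * ε k * W) := by
    have h1 := hP.integral_hessian_add_le hΩ hu hζ.continuous hζc (hq k) (hqc k) (hqU k)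
      (hsym k) (hell k) (hC k) ((j1.const_mul (C₁ * Kl)).add (j2.const_mul (C₁ * ε k))) ?_
    · refine h1.trans (le_of_eq ?_)
      congr 1
      refine (integral_add (j1.const_mul (C₁ * Kl)) (j2.const_mul (C₁ * ε k))).trans ?_
      rw [integral_const_mul, integral_const_mul]
    · filter_upwards [hqN k, hs k, hb k, hσ.ae_le hbc, hσ.ae_le hl] with y h2 h3 h4 h5 h6
      have e1 : ∑ i, ∑ j, q k i j y * N y j * Du₀ i y * u₀ y =
          ζ y * s k y * ((∑ i, b k i y * Du₀ i y) * u₀ y) := by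
        rw [Finset.sum_mul, Finset.mul_sum]
        refine Finset.sum_congr rfl fun i _ => ?_
        rw [← Finset.sum_mul, ← Finset.sum_mul, h2 i]
        ring
      -- The boundary condition for `β` is used here; replacing `β` by `b k` costs an error of size
      -- `ε k`.
      have e2 : (∑ i, b k i y * Du₀ i y) * u₀ y =
          -l y * u₀ y ^ 2 + (∑ i, (b k i y - β i y) * Du₀ i y) * u₀ y := by
        simp only [sub_mul, Finset.sum_sub_distrib]
        have : ∑ i, β i y * Du₀ i y = -(l y * u₀ y) := by linarith
        rw [this]
        ring
      have e3 : (∑ i, (b k i y - β i y) * Du₀ i y) * u₀ y ≤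
          ε k * ((∑ i, |Du₀ i y|) * |u₀ y|) := by
        refine (le_abs_self _).trans ?_
        rw [abs_mul, ← mul_assoc, Finset.mul_sum]
        refine mul_le_mul_of_nonneg_right ?_ (abs_nonneg _)
        refine (Finset.abs_sum_le_sum_abs _ _).trans (Finset.sum_le_sum fun i _ => ?_)
        rw [abs_mul]
        exact mul_le_mul_of_nonneg_right (h4 i) (abs_nonneg _)
      have e4 : (∑ i, b k i y * Du₀ i y) * u₀ y ≤
          Kl * u₀ y ^ 2 + ε k * ((∑ i, |Du₀ i y|) * |u₀ y|) := by
        rw [e2]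
        have := mul_le_mul_of_nonneg_right h6 (sq_nonneg (u₀ y))
        linarith
      have e5 : 0 ≤ Kl * u₀ y ^ 2 + ε k * ((∑ i, |Du₀ i y|) * |u₀ y|) := by
        -- Nonnegativity of `ε k` is read off from an index `i`; without indices the sum is empty.
        rcases isEmpty_or_nonempty (Fin n) with hn | ⟨⟨i⟩⟩
        · simp; positivity
        · have := (abs_nonneg _).trans (h4 i)
          positivity
      rw [e1]
      refine (mul_le_mul_of_nonneg_left e4 h3.1).trans
        ((mul_le_mul_of_nonneg_right h3.2 e5).trans (le_of_eq ?_))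
      simp only [Pi.add_apply]
      ring
  have hlim : Tendsto (fun k => ∫ x in Ω, ζ x * (∑ i, ∑ j, A k i j x * D2u i j x) * u x) atTop
      (𝓝 (∫ x in Ω, ζ x * (∑ i, ∑ j, a i j x * D2u i j x) * u x)) := by
    -- `A k` converges almost everywhere under the uniform bound `Ca`, and the products of the
    -- second derivatives with `u` are integrable.
    refine tendsto_integral_of_dominated_convergence
      (fun x => Z * Ca * ((∑ i, ∑ j, |D2u i j x|) * |u x|)) (fun k => ?_) ?_ (fun k => ?_) ?_
    · refine AEStronglyMeasurable.mul (AEStronglyMeasurable.mul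
        hζ.continuous.aestronglyMeasurable ?_) hu2.1
      refine Finset.aestronglyMeasurable_fun_sum _ fun i _ =>
        Finset.aestronglyMeasurable_fun_sum _ fun j _ => ?_
      exact (hA k i j).aestronglyMeasurable.mul (hD2u2 i j).1
    · refine Integrable.const_mul ?_ _
      simp_rw [Finset.sum_mul]
      exact integrable_finsetSum _ fun i _ => integrable_finsetSum _ fun j _ =>
        ((hD2u2 i j).abs).integrable_mul hu2.abs
    · refine Eventually.of_forall fun x => ?_
      rw [Real.norm_eq_abs, abs_mul, abs_mul, ← mul_assoc, mul_assoc Z]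
      refine mul_le_mul_of_nonneg_right (mul_le_mul (hZ x) ?_ (abs_nonneg _) hZ0) (abs_nonneg _)
      rw [Finset.mul_sum]
      refine (Finset.abs_sum_le_sum_abs _ _).trans (Finset.sum_le_sum fun i _ => ?_)
      rw [Finset.mul_sum]
      refine (Finset.abs_sum_le_sum_abs _ _).trans (Finset.sum_le_sum fun j _ => ?_)
      rw [abs_mul]
      exact mul_le_mul_of_nonneg_right (hACa k i j x) (abs_nonneg _)
    · have hall : ∀ᵐ x ∂(volume.restrict Ω), ∀ i j,
          Tendsto (fun k => A k i j x) atTop (𝓝 (a i j x)) :=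
        ae_all_iff.2 fun i => ae_all_iff.2 fun j =>
          (ae_restrict_iff' hΩ.measurableSet).2 (hAa i j)
      filter_upwards [hall] with x hx
      refine ((tendsto_finsetSum _ fun i _ => tendsto_finsetSum _ fun j _ =>
        (hx i j).mul_const _).const_mul _).mul_const _
  have hrhs : Tendsto (fun k => n * C * P + (C₁ * Kl * T + C₁ * ε k * W)) atTop
      (𝓝 (n * C * P + C₁ * Kl * T)) := by
    have := (((hε.const_mul C₁).mul_const W).const_add (C₁ * Kl * T)).const_add (n * C * P)
    simpa using this
  have hfin := le_of_tendsto_of_tendsto' (hlim.add_const (lam * Q)) hrhs hk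
  -- The surviving boundary integral `T` is turned into interior integrals.
  have htr := hP.integral_trace_sq_le hu.trace hζ hζc hζU hZ hZ' hv hvN
  have := mul_le_mul_of_nonneg_left htr (show 0 ≤ C₁ * Kl by positivity)
  linarith

end

/-! ### The matrix with oblique conormal. -/

noncomputable section

section ObliqueMatrix

variable {n : ℕ} (ν : EuclideanSpace ℝ (Fin n)) (A : Fin n → Fin n → ℝ) (b : Fin n → ℝ)

/-- The quotient of `⟪ν, A ν⟫` and `⟪b, ν⟫`. -/
def obliqueScale : ℝ := (∑ k, ∑ m, A k m * ν k * ν m) / ∑ k, b k * ν k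

/-- The difference of the conormal `A ν` and the multiple of `b` with the same normal component. -/
def obliqueTangent (i : Fin n) : ℝ := ∑ k, A i k * ν k - obliqueScale ν A b * b i

/-- The matrix with the same symmetric part as `A` whose conormal is a multiple of `b`. -/
def obliqueMatrix (i j : Fin n) : ℝ :=
  A i j + (ν i * obliqueTangent ν A b j - obliqueTangent ν A b i * ν j) / ∑ k, ν k ^ 2

theorem obliqueMatrix_add_swap (i j : Fin n) :
    obliqueMatrix ν A b i j + obliqueMatrix ν A b j i = A i j + A j i := by
  unfold obliqueMatrix; ring

/-- The scale is chosen so that `τ = A ν - s b` is orthogonal to `ν`. The antisymmetric correction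
then maps `ν` to `-τ`, leaving `A ν - τ = s b`. -/
theorem sum_obliqueMatrix_mul_normal (hν : ∑ k, ν k ^ 2 ≠ 0) (hb : ∑ k, b k * ν k ≠ 0)
    (i : Fin n) : ∑ j, obliqueMatrix ν A b i j * ν j = obliqueScale ν A b * b i := by
  have h1 : ∑ j, obliqueTangent ν A b j * ν j = 0 := by
    have e1 : ∑ j, obliqueTangent ν A b j * ν j =
        (∑ k, ∑ m, A k m * ν k * ν m) - obliqueScale ν A b * ∑ k, b k * ν k := by
      rw [Finset.mul_sum, ← Finset.sum_sub_distrib]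
      refine Finset.sum_congr rfl fun k _ => ?_
      rw [obliqueTangent, sub_mul, Finset.sum_mul, mul_assoc]
      congr 1
      exact Finset.sum_congr rfl fun m _ => by ring
    rw [e1, obliqueScale, div_mul_cancel₀ _ hb, sub_self]
  have h2 : ∑ j, obliqueMatrix ν A b i j * ν j = ∑ j, A i j * ν j +
      (ν i * ∑ j, obliqueTangent ν A b j * ν j - obliqueTangent ν A b i * ∑ k, ν k ^ 2) /
        ∑ k, ν k ^ 2 := by
    rw [Finset.mul_sum, Finset.mul_sum, ← Finset.sum_sub_distrib, Finset.sum_div,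
      ← Finset.sum_add_distrib]
    refine Finset.sum_congr rfl fun j _ => ?_
    rw [obliqueMatrix]; ring
  rw [h2, h1, mul_zero, zero_sub, neg_div, mul_div_cancel_right₀ _ hν, obliqueTangent]
  ring

theorem sum_obliqueMatrix_quadratic (ξ : Fin n → ℝ) :
    ∑ i, ∑ j, obliqueMatrix ν A b i j * ξ i * ξ j = ∑ i, ∑ j, A i j * ξ i * ξ j := by
  have := sum_mul_eq_of_symm (q := obliqueMatrix ν A b) (A := A) (S := fun i j => ξ i * ξ j)
    (z := 1) (fun i j => by rw [obliqueMatrix_add_swap, one_mul]) (fun i j => mul_comm _ _)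
  simpa only [one_mul, mul_assoc] using this

end ObliqueMatrix

variable {n : ℕ} {Ω U : Set (EuclideanSpace ℝ (Fin n))}
  {N : EuclideanSpace ℝ (Fin n) → EuclideanSpace ℝ (Fin n)}

theorem partialDeriv_eq_zero_of_notMem_tsupport {f : EuclideanSpace ℝ (Fin n) → ℝ}
    {y : EuclideanSpace ℝ (Fin n)} (hy : y ∉ tsupport f) (j : Fin n) : partialDeriv j f y = 0 := by
  have : y ∉ tsupport (fderiv ℝ f) := fun h => hy (tsupport_fderiv_subset ℝ h)
  rw [partialDeriv, image_eq_zero_of_notMem_tsupport this]; simp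

/-- The point and the values of the matrix and the vector are independent variables here.
Compactness in this finite-dimensional space later gives bounds uniform in the coefficients. -/
theorem contDiffOn_obliqueScale (hN : ContDiff ℝ 1 N) :
    ContDiffOn ℝ 1 (fun p : EuclideanSpace ℝ (Fin n) × (Fin n → Fin n → ℝ) × (Fin n → ℝ) =>
      obliqueScale (N p.1) p.2.1 p.2.2) {p | 0 < ∑ k, p.2.2 k * N p.1 k} := by
  have hNk (k : Fin n) : ContDiff ℝ 1
      (fun p : EuclideanSpace ℝ (Fin n) × (Fin n → Fin n → ℝ) × (Fin n → ℝ) => N p.1 k) :=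
    ((EuclideanSpace.proj (𝕜 := ℝ) k).contDiff.comp hN).comp contDiff_fst
  unfold obliqueScale
  refine ContDiffOn.div (ContDiff.contDiffOn ?_) (ContDiff.contDiffOn ?_) fun p hp => ne_of_gt hp
  · exact ContDiff.sum fun k _ => ContDiff.sum fun m _ =>
      (ContDiff.mul (by fun_prop) (hNk k)).mul (hNk m)
  · exact ContDiff.sum fun k _ => ContDiff.mul (by fun_prop) (hNk k)

theorem contDiffOn_mul_obliqueMatrix (hN : ContDiff ℝ 1 N) (hN0 : ∀ y, ∑ k, N y k ^ 2 ≠ 0)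
    {ζ : EuclideanSpace ℝ (Fin n) → ℝ} (hζ : ContDiff ℝ 1 ζ) (i j : Fin n) :
    ContDiffOn ℝ 1 (fun p : EuclideanSpace ℝ (Fin n) × (Fin n → Fin n → ℝ) × (Fin n → ℝ) =>
      ζ p.1 * obliqueMatrix (N p.1) p.2.1 p.2.2 i j) {p | 0 < ∑ k, p.2.2 k * N p.1 k} := by
  have hNk (k : Fin n) : ContDiff ℝ 1
      (fun p : EuclideanSpace ℝ (Fin n) × (Fin n → Fin n → ℝ) × (Fin n → ℝ) => N p.1 k) :=
    ((EuclideanSpace.proj (𝕜 := ℝ) k).contDiff.comp hN).comp contDiff_fst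
  have hs := contDiffOn_obliqueScale hN
  have hτ (i : Fin n) : ContDiffOn ℝ 1
      (fun p : EuclideanSpace ℝ (Fin n) × (Fin n → Fin n → ℝ) × (Fin n → ℝ) =>
        obliqueTangent (N p.1) p.2.1 p.2.2 i) {p | 0 < ∑ k, p.2.2 k * N p.1 k} := by
    unfold obliqueTangent
    refine ContDiffOn.sub (ContDiff.contDiffOn ?_) (hs.mul (ContDiff.contDiffOn (by fun_prop)))
    exact ContDiff.sum fun k _ => ContDiff.mul (by fun_prop) (hNk k)
  unfold obliqueMatrix
  refine ContDiffOn.mul (hζ.comp contDiff_fst).contDiffOn (ContDiffOn.add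
    (ContDiff.contDiffOn (by fun_prop)) (ContDiffOn.div ?_ (ContDiff.contDiffOn ?_)
      fun p _ => hN0 p.1))
  · exact ((hNk i).contDiffOn.mul (hτ j)).sub ((hτ i).mul (hNk j).contDiffOn)
  · exact ContDiff.sum fun k _ => (hNk k).pow 2

/-- Bounds for the matrix with prescribed oblique conormal, uniform with respect to the
coefficients. -/
theorem exists_bound_obliqueMatrix (hN : ContDiff ℝ 1 N) (hN0 : ∀ y, ∑ k, N y k ^ 2 ≠ 0)
    {ζ : EuclideanSpace ℝ (Fin n) → ℝ} (hζ : ContDiff ℝ 1 ζ) (x₀ : EuclideanSpace ℝ (Fin n))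
    {κ Ka Kb Ka' Kb' : ℝ} (hκ : 0 < κ) (hKa : 0 ≤ Ka) (hKb : 0 ≤ Kb) (hKa' : 0 ≤ Ka')
    (hKb' : 0 ≤ Kb') :
    ∃ C : ℝ, 0 ≤ C ∧ ∀ y ∈ Metric.closedBall x₀ 1,
      ∀ (A : Fin n → Fin n → EuclideanSpace ℝ (Fin n) → ℝ)
        (b : Fin n → EuclideanSpace ℝ (Fin n) → ℝ),
      (∀ i j, |A i j y| ≤ Ka) → (∀ i, |b i y| ≤ Kb) → κ ≤ ∑ k, b k y * N y k →
      |obliqueScale (N y) (fun i j => A i j y) (fun i => b i y)| ≤ C ∧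
      ((∀ i j, ContDiff ℝ 1 (A i j)) → (∀ i, ContDiff ℝ 1 (b i)) →
        (∀ i j m, |partialDeriv m (A i j) y| ≤ Ka') → (∀ i m, |partialDeriv m (b i) y| ≤ Kb') →
        ∀ i j m, |partialDeriv m (fun y => ζ y *
          obliqueMatrix (N y) (fun i j => A i j y) (fun i => b i y) i j) y| ≤ C) := by
  let O : Set (EuclideanSpace ℝ (Fin n) × (Fin n → Fin n → ℝ) × (Fin n → ℝ)) :=
    {p | 0 < ∑ k, p.2.2 k * N p.1 k}
  -- All admissible values form a compact set on which the denominator is at least `κ`.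
  let S : Set (EuclideanSpace ℝ (Fin n) × (Fin n → Fin n → ℝ) × (Fin n → ℝ)) :=
    Metric.closedBall x₀ 1 ×ˢ Metric.closedBall 0 Ka ×ˢ Metric.closedBall 0 Kb ∩
      {p | κ ≤ ∑ k, p.2.2 k * N p.1 k}
  have hcont : Continuous
      (fun p : EuclideanSpace ℝ (Fin n) × (Fin n → Fin n → ℝ) × (Fin n → ℝ) =>
        ∑ k, p.2.2 k * N p.1 k) :=
    continuous_finsetSum _ fun k _ => Continuous.mul (by fun_prop)
      ((EuclideanSpace.proj (𝕜 := ℝ) k).continuous.comp (hN.continuous.comp continuous_fst))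
  have hO : IsOpen O := isOpen_lt continuous_const hcont
  have hS : IsCompact S :=
    ((isCompact_closedBall _ _).prod ((isCompact_closedBall _ _).prod
      (isCompact_closedBall _ _))).inter_right (isClosed_le continuous_const hcont)
  have hSO : S ⊆ O := fun p hp => hκ.trans_le hp.2
  obtain ⟨C₁, hC₁⟩ := hS.exists_bound_of_continuousOn
    ((contDiffOn_obliqueScale hN).continuousOn.mono hSO)
  have hG (i j : Fin n) := contDiffOn_mul_obliqueMatrix hN hN0 hζ i j
  have hbd (i j : Fin n) := hS.exists_bound_of_continuousOn
    (((hG i j).continuousOn_fderiv_of_isOpen hO le_rfl).mono hSO)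
  choose C₂ hC₂ using hbd
  -- `M` bounds the derivative of `y ↦ (y, A y, b y)` along a unit coordinate vector in the product
  -- sup norm.
  set M : ℝ := 1 + Ka' + Kb' with hM
  refine ⟨|C₁| + ∑ i, ∑ j, |C₂ i j| * M, by positivity, ?_⟩
  intro y hy A b hA hb hκb
  have hp : (y, (fun i j => A i j y), fun i => b i y) ∈ S := by
    refine ⟨⟨hy, ?_, ?_⟩, hκb⟩
    · rw [mem_closedBall_zero_iff, pi_norm_le_iff_of_nonneg hKa]
      intro i
      rw [pi_norm_le_iff_of_nonneg hKa]
      exact hA i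
    · rw [mem_closedBall_zero_iff, pi_norm_le_iff_of_nonneg hKb]
      exact hb
  have hsum0 : 0 ≤ ∑ i, ∑ j, |C₂ i j| * M := by positivity
  refine ⟨((hC₁ _ hp).trans (le_abs_self _)).trans (by linarith), ?_⟩
  intro hA1 hb1 hA' hb' i j m
  have hder : HasFDerivAt (fun y => (y, (fun i j => A i j y), fun i => b i y))
      ((ContinuousLinearMap.id ℝ (EuclideanSpace ℝ (Fin n))).prod
        ((ContinuousLinearMap.pi fun i => ContinuousLinearMap.pi fun j => fderiv ℝ (A i j) y).prod
          (ContinuousLinearMap.pi fun i => fderiv ℝ (b i) y))) y := by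
    refine (hasFDerivAt_id y).prodMk (HasFDerivAt.prodMk ?_ ?_)
    · exact hasFDerivAt_pi.2 fun i => hasFDerivAt_pi.2 fun j =>
        ((hA1 i j).differentiable one_ne_zero y).hasFDerivAt
    · exact hasFDerivAt_pi.2 fun i => ((hb1 i).differentiable one_ne_zero y).hasFDerivAt
  have hGd := (((hG i j).contDiffAt (hO.mem_nhds (hSO hp))).differentiableAt
    one_ne_zero).hasFDerivAt
  have hcomp := (hGd.comp y hder).fderiv
  rw [Function.comp_def] at hcomp
  rw [partialDeriv, hcomp, ContinuousLinearMap.comp_apply]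
  refine ((ContinuousLinearMap.le_opNorm _ _).trans
    (mul_le_mul ((hC₂ i j _ hp).trans (le_abs_self _)) (?_ : _ ≤ M) (norm_nonneg _)
      (abs_nonneg _))).trans ?_
  · rw [norm_prod_le_iff, norm_prod_le_iff]
    refine ⟨?_, ?_, ?_⟩
    · simp [hM]; linarith
    · refine (pi_norm_le_iff_of_nonneg (by positivity)).2 fun i =>
        (pi_norm_le_iff_of_nonneg (by positivity)).2 fun j => (hA' i j m).trans ?_
      rw [hM]; linarith
    · refine (pi_norm_le_iff_of_nonneg (by positivity)).2 fun i => (hb' i m).trans ?_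
      rw [hM]; linarith
  · have h1 : |C₂ i j| * M ≤ ∑ j, |C₂ i j| * M :=
      Finset.single_le_sum (f := fun j => |C₂ i j| * M) (fun j _ => by positivity)
        (Finset.mem_univ j)
    have h2 : ∑ j, |C₂ i j| * M ≤ ∑ i, ∑ j, |C₂ i j| * M :=
      Finset.single_le_sum (f := fun i => ∑ j, |C₂ i j| * M) (fun j _ => by positivity)
        (Finset.mem_univ i)
    have := abs_nonneg C₁
    linarith

end

/-! ### Local energy estimates in the interior and at the boundary. -/

section

variable {n : ℕ} {Ω : Set (EuclideanSpace ℝ (Fin n))}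

theorem IsLocalGraph.fderiv_apply_eq_zero {x v : EuclideanSpace ℝ (Fin n)}
    {h : EuclideanSpace ℝ (Fin n) → ℝ} {r : ℝ} (H : IsLocalGraph Ω x v h r)
    (y : EuclideanSpace ℝ (Fin n)) : fderiv ℝ h y v = 0 := by
  have h1 : HasDerivAt (fun t : ℝ => y + t • v) v 0 := by
    simpa using ((hasDerivAt_id (0 : ℝ)).smul_const v).const_add y
  have h2 := (show HasFDerivAt h (fderiv ℝ h y) (y + (0 : ℝ) • v) by
    simpa using (H.contDiff.differentiable (by simp) y).hasFDerivAt).comp_hasDerivAt 0 h1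
  have h3 : (h ∘ fun t : ℝ => y + t • v) = fun _ => h y := by ext t; simp [H.invariant]
  rw [h3] at h2
  exact h2.unique (hasDerivAt_const _ _)

/-- As `h` does not vary along `v`, its gradient is orthogonal to `v`. So `v` is transversal to the
boundary, as the trace inequality requires, and the unnormalized normal never vanishes. -/
theorem IsLocalGraph.inner_normal {x v : EuclideanSpace ℝ (Fin n)}
    {h : EuclideanSpace ℝ (Fin n) → ℝ} {r : ℝ} (H : IsLocalGraph Ω x v h r)
    (y : EuclideanSpace ℝ (Fin n)) : inner ℝ (v - gradient h y) v = (1 : ℝ) := by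
  rw [inner_sub_left, inner_gradient_left, H.fderiv_apply_eq_zero, real_inner_self_eq_norm_sq,
    H.norm_eq_one]
  norm_num

theorem IsLocalGraph.one_le_norm_normal {x v : EuclideanSpace ℝ (Fin n)}
    {h : EuclideanSpace ℝ (Fin n) → ℝ} {r : ℝ} (H : IsLocalGraph Ω x v h r)
    (y : EuclideanSpace ℝ (Fin n)) : 1 ≤ ‖v - gradient h y‖ := by
  have := real_inner_le_norm (v - gradient h y) v
  rwa [H.inner_normal, H.norm_eq_one, mul_one] at this

theorem IsLocalGraph.hasInwardCone {x v : EuclideanSpace ℝ (Fin n)}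
    {h : EuclideanSpace ℝ (Fin n) → ℝ} {r : ℝ} (H : IsLocalGraph Ω x v h r) :
    HasInwardCone Ω (Metric.ball x (r / 2)) v := by
  have hr := H.radius_pos
  obtain ⟨L, hL⟩ := ContDiffOn.exists_lipschitzOnWith (s := Metric.closedBall x r)
    H.contDiff.contDiffOn (by simp) (convex_closedBall x r) (isCompact_closedBall x r)
  have hL1 : (0 : ℝ) < 1 + L := by positivity
  -- A perturbation `e` changes `⟪v, ·⟫ - h` by at most `(1 + L) * ‖e‖`. With this `c` it uses at
  -- most half of the drop `δ` won by moving against `v`; `r / 4` keeps the points in the chart.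
  refine ⟨1 / (2 * (1 + L)), r / 4, by positivity, by positivity, ?_⟩
  rintro y ⟨hy, hyΩ⟩ δ ⟨hδ, hδr⟩ z hz
  rw [Metric.mem_ball] at hy
  rw [Metric.mem_closedBall] at hz
  set e := z - (y - δ • v) with he
  have hcL : 1 / (2 * (1 + (L : ℝ))) * δ * (1 + L) = δ / 2 := by field_simp
  have hc0 : 0 ≤ 1 / (2 * (1 + (L : ℝ))) * δ := by positivity
  have hcδ : 1 / (2 * (1 + (L : ℝ))) * δ ≤ δ / 2 := by
    have : 0 ≤ 1 / (2 * (1 + (L : ℝ))) * δ * L := by positivity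
    linarith
  have hen : ‖e‖ ≤ 1 / (2 * (1 + L)) * δ := by rwa [he, ← dist_eq_norm]
  have hzy : z = y + e + (-δ) • v := by rw [he]; module
  have hye : y + e ∈ Metric.closedBall x r := by
    rw [Metric.mem_closedBall]
    have : dist (y + e) y = ‖e‖ := by simp [dist_eq_norm]
    linarith [dist_triangle (y + e) y x]
  have hyb : y ∈ Metric.ball x r := by rw [Metric.mem_ball]; linarith
  have hzb : z ∈ Metric.ball x r := by
    rw [Metric.mem_ball]
    have : dist z (y + e) = δ := by
      rw [hzy, dist_eq_norm, add_sub_cancel_left, norm_smul, H.norm_eq_one]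
      simp [abs_of_pos hδ]
    have h2 : dist (y + e) y = ‖e‖ := by simp [dist_eq_norm]
    linarith [dist_triangle z (y + e) x, dist_triangle (y + e) y x]
  have hmem : z ∈ Ω ∩ Metric.ball x r := by
    rw [H.inter_ball]
    refine ⟨hzb, ?_⟩
    have h1 := H.inner_le_of_mem_closure hyb hyΩ
    have h2 : |h (y + e) - h y| ≤ L * ‖e‖ := by
      have := hL.dist_le_mul _ hye _ (Metric.ball_subset_closedBall hyb)
      simpa [Real.dist_eq, dist_eq_norm] using this
    have h3 : inner ℝ v e ≤ ‖e‖ := by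
      simpa [H.norm_eq_one] using real_inner_le_norm v e
    have h4 : h z = h (y + e) := by rw [hzy, H.invariant]
    have h5 : inner ℝ v z = inner ℝ v y + inner ℝ v e - δ := by
      rw [hzy, inner_add_right, inner_add_right, inner_smul_right, real_inner_self_eq_norm_sq,
        H.norm_eq_one]
      ring
    have h6 := (abs_le.1 h2).1
    have h7 : ‖e‖ * (1 + L) ≤ δ / 2 := by
      rw [← hcL]; exact mul_le_mul_of_nonneg_right hen hL1.le
    rw [h4, h5]
    linarith
  exact hmem.1

/-- The bounds on the leading coefficients and on the boundary operator. -/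
structure IsAdmissible (Ω : Set (EuclideanSpace ℝ (Fin n))) (Ka Kβ Kl : ℝ≥0) (lam chi : ℝ)
    (a : Fin n → Fin n → EuclideanSpace ℝ (Fin n) → ℝ)
    (β : Fin n → EuclideanSpace ℝ (Fin n) → ℝ) (l : EuclideanSpace ℝ (Fin n) → ℝ) : Prop where
  bound : ∀ i j, W1InftyBound Ω (a i j) Ka
  boundary_bound : ∀ i, W1InftyBoundaryBound Ω (β i) Kβ
  neg_le : ∀ᵐ x ∂(surfaceMeasure Ω), -l x ≤ Kl
  elliptic : ∀ᵐ x ∂(volume.restrict Ω), ∀ ξ : EuclideanSpace ℝ (Fin n),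
    lam * ‖ξ‖ ^ 2 ≤ ∑ i, ∑ j, a i j x * ξ i * ξ j
  oblique : ∀ x ∈ frontier Ω, ∀ ν : EuclideanSpace ℝ (Fin n), IsOuterUnitNormal Ω x ν →
    chi ≤ ∑ i, β i x * ν i

/-- The energy estimate localized by `ζ` holds uniformly for all admissible coefficients. -/
def HasEnergyEstimate (Ω : Set (EuclideanSpace ℝ (Fin n))) (Ka Kβ Kl : ℝ≥0) (lam chi : ℝ)
    (ζ : EuclideanSpace ℝ (Fin n) → ℝ) : Prop :=
  ∃ C : ℝ, 0 ≤ C ∧ ∀ (a : Fin n → Fin n → EuclideanSpace ℝ (Fin n) → ℝ)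
    (β : Fin n → EuclideanSpace ℝ (Fin n) → ℝ) (l : EuclideanSpace ℝ (Fin n) → ℝ),
    IsAdmissible Ω Ka Kβ Kl lam chi a β l →
    ∀ (u : EuclideanSpace ℝ (Fin n) → ℝ) (Du : Fin n → EuclideanSpace ℝ (Fin n) → ℝ)
      (D2u : Fin n → Fin n → EuclideanSpace ℝ (Fin n) → ℝ)
      (u₀ : EuclideanSpace ℝ (Fin n) → ℝ) (Du₀ : Fin n → EuclideanSpace ℝ (Fin n) → ℝ),
      IsH2WithTraces Ω u Du D2u u₀ Du₀ →
      (∀ᵐ x ∂(surfaceMeasure Ω), ∑ i, β i x * Du₀ i x + l x * u₀ x = 0) →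
      (∫ x in Ω, ζ x * (∑ i, ∑ j, a i j x * D2u i j x) * u x) +
        lam * (∫ x in Ω, ζ x * ∑ i, Du i x ^ 2) ≤
      C * ((∫ x in Ω, (∑ i, |Du i x|) * |u x|) + ∫ x in Ω, u x ^ 2)

theorem exists_bound_of_contDiff {ζ : EuclideanSpace ℝ (Fin n) → ℝ} (hζ : ContDiff ℝ 1 ζ)
    (hζc : HasCompactSupport ζ) :
    ∃ Z : ℝ, 0 ≤ Z ∧ (∀ y, |ζ y| ≤ Z) ∧ ∀ j y, |partialDeriv j ζ y| ≤ Z := by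
  obtain ⟨Z, hZ⟩ := hζ.continuous.bounded_above_of_compact_support hζc
  obtain ⟨Z', hZ'⟩ := (hζ.continuous_fderiv one_ne_zero).bounded_above_of_compact_support
    (hζc.fderiv ℝ)
  have h0 : 0 ≤ Z := (norm_nonneg _).trans (hZ 0)
  have h0' : 0 ≤ Z' := (norm_nonneg _).trans (hZ' 0)
  refine ⟨Z + Z', by positivity, fun y => (hZ y).trans (by linarith), fun j y => ?_⟩
  have h1 := (fderiv ℝ ζ y).le_opNorm (EuclideanSpace.single j 1)
  simp only [PiLp.norm_single, norm_one, mul_one] at h1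
  exact h1.trans ((hZ' y).trans (by linarith))

theorem add_mul_le_of_nonneg {A B P R : ℝ} (hA : 0 ≤ A) (hB : 0 ≤ B) (hP : 0 ≤ P) (hR : 0 ≤ R) :
    A * P + B * R ≤ (A + B) * (P + R) := by
  have := mul_nonneg hA hR
  have := mul_nonneg hB hP
  linarith

/-- Away from the boundary no correction is needed: `q = ζ A`, the boundary measure is zero, and the
inward direction can be `v = 0`. -/
theorem exists_hasEnergyEstimate_interior (hΩ : IsOpen Ω) (hb : Bornology.IsBounded Ω)
    (Ka Kβ Kl : ℝ≥0) (lam chi : ℝ) {x₀ : EuclideanSpace ℝ (Fin n)}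
    (hx₀ : x₀ ∈ Ω) : ∃ r > 0, ∀ ζ : EuclideanSpace ℝ (Fin n) → ℝ, ContDiff ℝ ∞ ζ →
      tsupport ζ ⊆ Metric.ball x₀ r → (∀ y, 0 ≤ ζ y) →
      HasEnergyEstimate Ω Ka Kβ Kl lam chi ζ := by
  obtain ⟨R, hR, hRΩ⟩ := Metric.isOpen_iff.1 hΩ x₀ hx₀
  refine ⟨R / 2, by positivity, fun ζ hζ hζr hζ0 => ?_⟩
  have hζ1 : ContDiff ℝ 1 ζ := hζ.of_le (by exact_mod_cast le_top)
  have hζc : HasCompactSupport ζ := (isCompact_closedBall x₀ (R / 2)).of_isClosed_subset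
    (isClosed_tsupport ζ) (hζr.trans Metric.ball_subset_closedBall)
  have hζΩ : tsupport ζ ⊆ Ω :=
    hζr.trans ((Metric.ball_subset_ball (by linarith)).trans hRΩ)
  obtain ⟨Z, hZ0, hZ, hZ'⟩ := exists_bound_of_contDiff hζ1 hζc
  have hcone : HasInwardCone Ω (Metric.ball x₀ (R / 2)) 0 := by
    refine ⟨1, R / 2, one_pos, by positivity, ?_⟩
    rintro y ⟨hy, -⟩ δ ⟨hδ, hδR⟩ z hz
    apply hRΩ
    rw [Metric.mem_ball] at hy ⊢
    rw [Metric.mem_closedBall, smul_zero, sub_zero, one_mul] at hz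
    linarith [dist_triangle z y x₀]
  refine ⟨n * (2 * (Z * Ka)), by positivity, fun a β l had u Du D2u u₀ Du₀ hu hbc => ?_⟩
  obtain ⟨A, hA, hAK, hAD, hAell, hAlim⟩ := hcone.exists_smooth_approx hΩ hb had.bound had.elliptic
  have hA1 (k i j) : ContDiff ℝ 1 (A k i j) := (hA k i j).of_le (by exact_mod_cast le_top)
  have hball {y} (hy : y ∈ tsupport ζ) (hyΩ : y ∈ Ω) : y ∈ Metric.ball x₀ (R / 2) ∩ closure Ω :=
    ⟨hζr hy, subset_closure hyΩ⟩
  have := (isGaussGreenPatch_interior Ω).energy_estimate hΩ hu hζ1 hζc hζΩ hZ hZ' (v := 0)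
    (by simp) (by simp) hbc had.neg_le (fun k i j => (hA k i j).continuous) hAK hAlim
    (q := fun k i j y => ζ y * A k i j y) (fun k i j => hζ1.mul (hA1 k i j))
    (fun k i j => hζc.mul_right) (fun k i j => tsupport_mul_subset_left.trans hζΩ)
    (fun k y _ i j => by ring) (lam := lam) (C := 2 * (Z * Ka)) (C₁ := 0) le_rfl
    (fun k y hy ξ => by
      by_cases hyζ : y ∈ tsupport ζ
      · have h1 := mul_le_mul_of_nonneg_left (hAell k y (hball hyζ hy) ξ) (hζ0 y)
        simp only [Finset.mul_sum] at h1
        simp only [mul_assoc] at h1 ⊢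
        linarith
      · simp [image_eq_zero_of_notMem_tsupport hyζ])
    (fun k y hy i j => by
      by_cases hyζ : y ∈ tsupport ζ
      · have h1 : partialDeriv j (fun y => ζ y * A k i j y) y =
            ζ y * partialDeriv j (A k i j) y + partialDeriv j ζ y * A k i j y := by
          simp only [partialDeriv]
          rw [fderiv_fun_mul (hζ1.differentiable one_ne_zero y)
            ((hA1 k i j).differentiable one_ne_zero y)]
          simp only [add_apply, smul_apply, smul_eq_mul]
          ring
        rw [h1]
        refine (abs_add_le _ _).trans ?_
        rw [abs_mul, abs_mul, two_mul]
        exact add_le_add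
          (mul_le_mul (hZ y) (hAD k i j y (hball hyζ hy) j) (abs_nonneg _) hZ0)
          (mul_le_mul (hZ' j y) (hAK k i j y) (abs_nonneg _) hZ0)
      · rw [partialDeriv_eq_zero_of_notMem_tsupport fun h => hyζ (tsupport_mul_subset_left h)]
        rw [abs_zero]; positivity)
    (b := fun _ _ _ => 0) (s := fun _ _ => 0) (by simp) (by simp) (ε := fun _ => 0)
    tendsto_const_nhds (by simp)
  refine this.trans ?_
  have h1 : 0 ≤ ∫ x in Ω, u x ^ 2 := integral_nonneg fun x => sq_nonneg _
  have h2 : 0 ≤ (n : ℝ) * (2 * (Z * Ka)) := by positivity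
  nlinarith [mul_nonneg h2 h1]

/-- Obliqueness at `x₀` persists, with constant `chi / 2`, for the smoothed extension of `β` and the
extended normal on a ball whose radius is fixed before the coefficients. There the oblique matrix is
defined with uniform bounds. -/
theorem exists_hasEnergyEstimate_boundary (hn : 1 ≤ n) (hΩ : IsSmoothBoundedDomain Ω)
    (Ka Kβ Kl : ℝ≥0) {lam chi : ℝ} (hlam : 0 < lam) (hchi : 0 < chi)
    {x₀ : EuclideanSpace ℝ (Fin n)}
    (hx₀ : x₀ ∈ frontier Ω) : ∃ r > 0, ∀ ζ : EuclideanSpace ℝ (Fin n) → ℝ, ContDiff ℝ ∞ ζ →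
      tsupport ζ ⊆ Metric.ball x₀ r → (∀ y, 0 ≤ ζ y) →
      HasEnergyEstimate Ω Ka Kβ Kl lam chi ζ := by
  obtain ⟨v, h, r₀, H⟩ := hΩ.smooth_boundary x₀ hx₀
  obtain ⟨σ, hP, hσ⟩ := H.exists_isGaussGreenPatch hn hΩ.isOpen
  have hr₀ := H.radius_pos
  set N : EuclideanSpace ℝ (Fin n) → EuclideanSpace ℝ (Fin n) := fun y => v - gradient h y with hNdef
  have hN : ContDiff ℝ 1 N := by
    refine contDiff_const.sub ?_
    exact (InnerProductSpace.toDual ℝ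
      (EuclideanSpace ℝ (Fin n))).symm.toContinuousLinearEquiv.contDiff.comp
        ((contDiff_infty.1 H.contDiff 2).fderiv_right (m := 1) (by norm_num))
  have hNsq (y) : ∑ k, N y k ^ 2 = ‖N y‖ ^ 2 := by simp [EuclideanSpace.norm_sq_eq]
  have hN1 (y) : 1 ≤ ‖N y‖ := H.one_le_norm_normal y
  have hN0 (y) : ∑ k, N y k ^ 2 ≠ 0 := by
    rw [hNsq]; have := hN1 y; positivity
  set T := ‖N x₀‖ + 1 with hT
  -- `T` bounds the normal near `x₀`. Each of the `n` terms of `⟪b, N⟫` may deviate by `(Kβ + 1) * η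
  -- * (T + 1)`, and these errors must add up to at most `chi / 2`.
  set η : ℝ := chi / (2 * ((n + 1) * (Kβ + 1) * (T + 1))) with hη
  have hT0 : 0 ≤ T := by positivity
  have hη0 : 0 < η := by positivity
  have hηchi : n * ((Kβ + 1) * η * (T + 1)) ≤ chi / 2 := by
    have : (n + 1) * ((Kβ + 1) * η * (T + 1)) = chi / 2 := by rw [hη]; field_simp
    have h2 : 0 ≤ (Kβ + 1) * η * (T + 1) := by positivity
    linarith
  obtain ⟨ρ, hρ, hρN⟩ := Metric.continuousAt_iff.1 (hN.continuous.continuousAt (x := x₀)) (min η 1)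
    (lt_min hη0 one_pos)
  set r := min (min (r₀ / 2) ρ) (min η 1) with hr
  have hr0 : 0 < r := by positivity
  have hrr₀ : r ≤ r₀ / 2 := (min_le_left _ _).trans (min_le_left _ _)
  have hrρ : r ≤ ρ := (min_le_left _ _).trans (min_le_right _ _)
  have hrη : r ≤ η := (min_le_right _ _).trans (min_le_left _ _)
  have hr1 : r ≤ 1 := (min_le_right _ _).trans (min_le_right _ _)
  refine ⟨r, hr0, fun ζ hζ hζr hζ0 => ?_⟩
  have hζ1 : ContDiff ℝ 1 ζ := hζ.of_le (by exact_mod_cast le_top)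
  have hζc : HasCompactSupport ζ := (isCompact_closedBall x₀ r).of_isClosed_subset
    (isClosed_tsupport ζ) (hζr.trans Metric.ball_subset_closedBall)
  have hζU : tsupport ζ ⊆ Metric.ball x₀ r₀ :=
    hζr.trans (Metric.ball_subset_ball (by linarith))
  obtain ⟨Z, hZ0, hZ, hZ'⟩ := exists_bound_of_contDiff hζ1 hζc
  obtain ⟨C, hC0, hC⟩ := exists_bound_obliqueMatrix hN hN0 hζ1 x₀ (κ := chi / 2) (Ka := Ka)
    (Kb := Kβ + (Kβ + 1) * η) (Ka' := Ka) (Kb' := Kβ) (by positivity) (by positivity)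
    (by positivity) (by positivity) (by positivity)
  refine ⟨n * C + C * Kl * (2 * Z) + C * Kl * (n * Z), by positivity,
    fun a β l had u Du D2u u₀ Du₀ hu hbc => ?_⟩
  obtain ⟨A, hA, hAK, hAD, hAell, hAlim⟩ :=
    H.hasInwardCone.exists_smooth_approx hΩ.isOpen hΩ.isBounded had.bound had.elliptic
  have hA1 (k i j) : ContDiff ℝ 1 (A k i j) := (hA k i j).of_le (by exact_mod_cast le_top)
  choose βe hβe hβeq using fun i => (had.boundary_bound i).2.extend_real
  choose F hF hFβ hFD using fun i => (hβe i).exists_smooth_approx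
  -- Early mollifications may fail to be oblique, so the sequence starts at `k₀`.
  obtain ⟨k₀, hk₀⟩ : ∃ k₀ : ℕ, ∀ k ≥ k₀, Kβ * (1 / ((k : ℝ) + 1)) ≤ η := by
    have : Tendsto (fun k : ℕ => (Kβ : ℝ) * (1 / ((k : ℝ) + 1))) atTop (𝓝 0) := by
      simpa using tendsto_one_div_add_atTop_nhds_zero_nat.const_mul (Kβ : ℝ)
    exact eventually_atTop.1 (this.eventually_le_const hη0)
  set b : ℕ → Fin n → EuclideanSpace ℝ (Fin n) → ℝ := fun k i => F i (k + k₀) with hbdef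
  have hb1 (k i) : ContDiff ℝ 1 (b k i) := (hF i (k + k₀)).of_le (by exact_mod_cast le_top)
  have hbx (k i) {y} (hy : y ∈ Metric.ball x₀ r) : |b k i y - β i x₀| ≤ (Kβ + 1) * η := by
    have h1 := (hFβ i (k + k₀) y).trans (hk₀ _ (Nat.le_add_left _ _))
    have h2 := (hβe i).dist_le_mul y x₀
    rw [Real.dist_eq] at h2
    have h3 : Kβ * dist y x₀ ≤ Kβ * η := by
      have := (Metric.mem_ball.1 hy).le.trans hrη
      gcongr
    have h4 := abs_sub_le (b k i y) (βe i y) (βe i x₀)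
    rw [hβeq i hx₀]
    simp only [hbdef] at h4 ⊢
    linarith
  have hβx (i) : |β i x₀| ≤ Kβ := (had.boundary_bound i).1 x₀ hx₀
  have hbK (k i) {y} (hy : y ∈ Metric.ball x₀ r) : |b k i y| ≤ Kβ + (Kβ + 1) * η := by
    have h1 := hbx k i hy
    have h2 := abs_add_le (β i x₀) (b k i y - β i x₀)
    rw [add_sub_cancel] at h2
    linarith [hβx i]
  -- The hypothesis concerns the unit normal; since `‖N x₀‖ ≥ 1`, removing the normalization only
  -- helps.
  have hβN : chi ≤ ∑ i, β i x₀ * N x₀ i := by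
    have h1 := had.oblique x₀ hx₀ (‖N x₀‖⁻¹ • N x₀) ⟨hx₀, v, h, r₀, H, rfl⟩
    have h2 : ∑ i, β i x₀ * (‖N x₀‖⁻¹ • N x₀) i = ‖N x₀‖⁻¹ * ∑ i, β i x₀ * N x₀ i := by
      rw [Finset.mul_sum]
      exact Finset.sum_congr rfl fun i _ => by simp; ring
    rw [h2, ← div_eq_inv_mul, le_div_iff₀ (by linarith [hN1 x₀])] at h1
    nlinarith [hN1 x₀]
  have hbN (k) {y} (hy : y ∈ Metric.ball x₀ r) : chi / 2 ≤ ∑ i, b k i y * N y i := by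
    have hNy := hρN (show dist y x₀ < ρ from (Metric.mem_ball.1 hy).trans_le hrρ)
    rw [dist_eq_norm] at hNy
    have hNi (i : Fin n) : |N y i - N x₀ i| ≤ η := by
      have := PiLp.norm_apply_le (N y - N x₀) i
      exact this.trans (hNy.le.trans (min_le_left _ _))
    have hNT (i : Fin n) : |N y i| ≤ T := by
      have h1 := PiLp.norm_apply_le (N y) i
      have h2 := norm_sub_norm_le (N y) (N x₀)
      have h3 := hNy.le.trans (min_le_right _ _)
      rw [Real.norm_eq_abs] at h1
      linarith
    have hterm (i : Fin n) : β i x₀ * N x₀ i - (Kβ + 1) * η * (T + 1) ≤ b k i y * N y i := by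
      have h1 : b k i y * N y i = β i x₀ * N x₀ i + (b k i y - β i x₀) * N y i +
        β i x₀ * (N y i - N x₀ i) := by ring
      have h2 : |(b k i y - β i x₀) * N y i| ≤ (Kβ + 1) * η * T := by
        rw [abs_mul]
        exact mul_le_mul (hbx k i hy) (hNT i) (abs_nonneg _) (by positivity)
      have h3 : |β i x₀ * (N y i - N x₀ i)| ≤ (Kβ + 1) * η := by
        rw [abs_mul]
        exact mul_le_mul ((hβx i).trans (by linarith)) (hNi i) (abs_nonneg _) (by positivity)
      have h4 := (abs_le.1 h2).1
      have h5 := (abs_le.1 h3).1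
      rw [h1]
      linarith
    have := Finset.sum_le_sum fun i (_ : i ∈ Finset.univ) => hterm i
    rw [Finset.sum_sub_distrib, Finset.sum_const, Finset.card_univ, Fintype.card_fin,
      nsmul_eq_mul] at this
    linarith
  have hball {y} (hy : y ∈ tsupport ζ) : y ∈ Metric.ball x₀ r := hζr hy
  have hball' {y} (hy : y ∈ tsupport ζ) : y ∈ Metric.closedBall x₀ 1 :=
    Metric.ball_subset_closedBall (Metric.ball_subset_ball hr1 (hball hy))
  have hball2 {y} (hy : y ∈ tsupport ζ) (hyΩ : y ∈ closure Ω) :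
      y ∈ Metric.ball x₀ (r₀ / 2) ∩ closure Ω :=
    ⟨Metric.ball_subset_ball hrr₀ (hball hy), hyΩ⟩
  have hσae : ∀ᵐ y ∂σ, y ∈ frontier Ω := by
    refine measure_mono_null (fun y hy => ?_) hσ
    exact fun hy' => hy hy'.1
  set s : ℕ → EuclideanSpace ℝ (Fin n) → ℝ := fun k y =>
    obliqueScale (N y) (fun i j => A k i j y) (fun i => b k i y) with hs
  set q : ℕ → Fin n → Fin n → EuclideanSpace ℝ (Fin n) → ℝ := fun k i j y =>
    ζ y * obliqueMatrix (N y) (fun i j => A k i j y) (fun i => b k i y) i j with hq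
  have hqts (k i j) : tsupport (q k i j) ⊆ tsupport ζ := tsupport_mul_subset_left
  have hbound (k) {y} (hy : y ∈ tsupport ζ) := hC y (hball' hy) (A k) (b k)
    (fun i j => hAK k i j y) (fun i => hbK k i (hball hy)) (hbN k (hball hy))
  -- The oblique matrix is regular only where `⟪b, N⟫ > 0`, which holds on the support of `ζ`;
  -- elsewhere `q` vanishes locally.
  have hqC1 (k i j) : ContDiff ℝ 1 (q k i j) := by
    rw [contDiff_iff_contDiffAt]
    intro y
    by_cases hy : y ∈ tsupport ζ
    · have hmem : (y, (fun i j => A k i j y), fun i => b k i y) ∈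
          {p : EuclideanSpace ℝ (Fin n) × (Fin n → Fin n → ℝ) × (Fin n → ℝ) |
            0 < ∑ k, p.2.2 k * N p.1 k} :=
        lt_of_lt_of_le (by positivity) (hbN k (hball hy))
      have hopen : IsOpen {p : EuclideanSpace ℝ (Fin n) × (Fin n → Fin n → ℝ) × (Fin n → ℝ) |
            0 < ∑ k, p.2.2 k * N p.1 k} :=
        isOpen_lt continuous_const (continuous_finsetSum _ fun k _ => Continuous.mul (by fun_prop)
          ((EuclideanSpace.proj (𝕜 := ℝ) k).continuous.comp
            (hN.continuous.comp continuous_fst)))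
      have h1 := (contDiffOn_mul_obliqueMatrix hN hN0 hζ1 i j).contDiffAt (hopen.mem_nhds hmem)
      have h2 : ContDiff ℝ 1 fun y => (y, (fun i j => A k i j y), fun i => b k i y) :=
        contDiff_id.prodMk ((contDiff_pi.2 fun i => contDiff_pi.2 fun j => hA1 k i j).prodMk
          (contDiff_pi.2 fun i => hb1 k i))
      exact h1.comp y h2.contDiffAt
    · have := notMem_tsupport_iff_eventuallyEq.1 fun h => hy (hqts k i j h)
      exact contDiffAt_const.congr_of_eventuallyEq this
  have hest := hP.energy_estimate hΩ.isOpen hu hζ1 hζc hζU hZ hZ' (v := v) H.norm_eq_one.le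
    (Eventually.of_forall fun y => by rw [H.inner_normal, mul_one]) hbc had.neg_le
    (fun k i j => (hA k i j).continuous) hAK hAlim (q := q) hqC1
    (fun k i j => hζc.mul_right) (fun k i j => (hqts k i j).trans hζU)
    (fun k y _ i j => by simp only [hq]; rw [← mul_add, obliqueMatrix_add_swap])
    (lam := lam) (C := C) (C₁ := C) hC0
    (fun k y hy ξ => by
      by_cases hyζ : y ∈ tsupport ζ
      · have h1 := mul_le_mul_of_nonneg_left (hAell k y (hball2 hyζ (subset_closure hy)) ξ) (hζ0 y)
        rw [← sum_obliqueMatrix_quadratic (N y) (fun i j => A k i j y) (fun i => b k i y)] at h1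
        simp only [Finset.mul_sum] at h1
        simp only [hq, mul_assoc] at h1 ⊢
        linarith
      · simp [hq, image_eq_zero_of_notMem_tsupport hyζ])
    (fun k y hy i j => by
      by_cases hyζ : y ∈ tsupport ζ
      · exact (hbound k hyζ).2 (hA1 k) (hb1 k)
          (fun i j m => hAD k i j y (hball2 hyζ (subset_closure hy)) m)
          (fun i m => hFD i _ m y) i j j
      · rw [partialDeriv_eq_zero_of_notMem_tsupport fun h => hyζ (hqts k i j h)]
        rwa [abs_zero])
    (b := b) (s := s)
    (fun k => Eventually.of_forall fun y i => by
      by_cases hyζ : y ∈ tsupport ζ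
      · have h1 := sum_obliqueMatrix_mul_normal (N y) (fun i j => A k i j y) (fun i => b k i y)
          (hN0 y) (lt_of_lt_of_le (by positivity) (hbN k (hball hyζ))).ne' i
        simp only [hq, hs]
        rw [mul_assoc (ζ y), ← h1, Finset.mul_sum]
        exact Finset.sum_congr rfl fun j _ => mul_assoc _ _ _
      · simp [hq, image_eq_zero_of_notMem_tsupport hyζ])
    (fun k => by
      filter_upwards [hσae] with y hy
      by_cases hyζ : y ∈ tsupport ζ
      · have h1 : 0 ≤ s k y := by
          refine div_nonneg ?_ ((by positivity : 0 ≤ chi / 2).trans (hbN k (hball hyζ)))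
          exact (by positivity : 0 ≤ lam * ‖N y‖ ^ 2).trans
            (hAell k y (hball2 hyζ (frontier_subset_closure hy)) (N y))
        refine ⟨mul_nonneg (hζ0 y) h1, ?_⟩
        rw [mul_comm C]
        exact mul_le_mul_of_nonneg_left ((le_abs_self _).trans (hbound k hyζ).1) (hζ0 y)
      · simp [image_eq_zero_of_notMem_tsupport hyζ])
    (ε := fun k => Kβ * (1 / (((k + k₀ : ℕ) : ℝ) + 1)))
    (by
      have := (tendsto_one_div_add_atTop_nhds_zero_nat (𝕜 := ℝ)).const_mul (Kβ : ℝ)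
      rw [mul_zero] at this
      exact this.comp (tendsto_add_atTop_nat k₀))
    (fun k => by
      filter_upwards [hσae] with y hy i
      have := hFβ i (k + k₀) y
      rwa [← hβeq i hy] at this)
  refine hest.trans (add_mul_le_of_nonneg (by positivity) (by positivity) ?_ ?_)
  · exact integral_nonneg fun x => by positivity
  · exact integral_nonneg fun x => sq_nonneg _

end

/-! ### Globalization and conclusion. -/

section

variable {n : ℕ} {Ω : Set (EuclideanSpace ℝ (Fin n))}

theorem integrable_sum_mul_mul {m : Measure (EuclideanSpace ℝ (Fin n))}
    {ζ : EuclideanSpace ℝ (Fin n) → ℝ} {Z : ℝ} (hζ : AEStronglyMeasurable ζ m)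
    (hZ : ∀ x, |ζ x| ≤ Z) {a : Fin n → Fin n → EuclideanSpace ℝ (Fin n) → ℝ} {K : ℝ≥0}
    (ha : ∀ i j, LInftyBound m (a i j) K)
    {D2u : Fin n → Fin n → EuclideanSpace ℝ (Fin n) → ℝ} (hD2u : ∀ i j, MemLp (D2u i j) 2 m)
    {u : EuclideanSpace ℝ (Fin n) → ℝ} (hu : MemLp u 2 m) :
    Integrable (fun x => ζ x * (∑ i, ∑ j, a i j x * D2u i j x) * u x) m := by
  simp_rw [Finset.mul_sum, Finset.sum_mul, ← mul_assoc]
  refine integrable_finsetSum _ fun i _ => integrable_finsetSum _ fun j _ => ?_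
  refine integrable_bdd_mul_mul (C := Z * K) (hζ.mul (ha i j).1) ?_ (hD2u i j) hu
  filter_upwards [(ha i j).ae_abs_le] with x hx
  rw [Pi.mul_apply, abs_mul]
  exact mul_le_mul (hZ x) hx (abs_nonneg _) ((abs_nonneg _).trans (hZ x))

/-- The energy estimate on the whole domain. -/
theorem IsSmoothBoundedDomain.hasEnergyEstimate (hn : 1 ≤ n) (hΩ : IsSmoothBoundedDomain Ω)
    (Ka Kβ Kl : ℝ≥0) {lam chi : ℝ} (hlam : 0 < lam) (hchi : 0 < chi) :
    HasEnergyEstimate Ω Ka Kβ Kl lam chi (fun _ => 1) := by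
  have hloc (x : EuclideanSpace ℝ (Fin n)) (hx : x ∈ closure Ω) :
      ∃ r > 0, ∀ ζ : EuclideanSpace ℝ (Fin n) → ℝ, ContDiff ℝ ∞ ζ →
      tsupport ζ ⊆ Metric.ball x r → (∀ y, 0 ≤ ζ y) →
      HasEnergyEstimate Ω Ka Kβ Kl lam chi ζ := by
    by_cases hxΩ : x ∈ Ω
    · exact exists_hasEnergyEstimate_interior hΩ.isOpen hΩ.isBounded Ka Kβ Kl lam chi hxΩ
    · exact exists_hasEnergyEstimate_boundary hn hΩ Ka Kβ Kl hlam hchi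
        (by rw [hΩ.isOpen.frontier_eq]; exact ⟨hx, hxΩ⟩)
  choose! r hr hest using hloc
  obtain ⟨t, ht, hcover⟩ := hΩ.isBounded.isCompact_closure.elim_nhds_subcover
    (fun x => Metric.ball x (r x)) fun x hx => Metric.ball_mem_nhds x (hr x hx)
  -- The local estimates carry `ζ` linearly on the left with the exact factor `lam`, so they can be
  -- summed without loss in the gradient term.
  obtain ⟨f, hf⟩ := SmoothPartitionOfUnity.exists_isSubordinate
    (modelWithCornersSelf ℝ (EuclideanSpace ℝ (Fin n))) (isClosed_closure (s := Ω))
    (fun i : t => Metric.ball (i : EuclideanSpace ℝ (Fin n)) (r i)) (fun i => Metric.isOpen_ball)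
    (hcover.trans fun y hy => by
      obtain ⟨x, hx, hxy⟩ := mem_iUnion₂.1 hy
      exact mem_iUnion.2 ⟨⟨x, hx⟩, hxy⟩)
  have hfs (i : t) : ContDiff ℝ ∞ (f i) := (f i).contMDiff.contDiff
  have hE (i : t) := hest i (ht i i.2) (f i) (hfs i) (hf i) (f.nonneg i)
  choose C hC0 hC using hE
  refine ⟨∑ i, C i, Finset.sum_nonneg fun i _ => hC0 i,
    fun a β l had u Du D2u u₀ Du₀ hu hbc => ?_⟩
  have h := Finset.sum_le_sum fun i (_ : i ∈ Finset.univ) =>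
    hC i a β l had u Du D2u u₀ Du₀ hu hbc
  have hu2 := hu.trace.1.memLp
  have hDu2 (i) := hu.trace.1.memLp_deriv i
  have hf1 (i : t) (x) : |f i x| ≤ 1 := by
    rw [abs_of_nonneg (f.nonneg i x)]; exact f.le_one i x
  have hsum (x) (hx : x ∈ Ω) : ∑ i, f i x = 1 := by
    rw [← finsum_eq_sum_of_fintype]; exact f.sum_eq_one (subset_closure hx)
  have i1 (i : t) : Integrable (fun x => f i x * (∑ i, ∑ j, a i j x * D2u i j x) * u x)
      (volume.restrict Ω) :=
    integrable_sum_mul_mul (hfs i).continuous.aestronglyMeasurable (hf1 i)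
      (fun i j => (had.bound i j).1) (fun i j => (hu.trace_deriv i).1.memLp_deriv j) hu2
  have i2 (i : t) : Integrable (fun x => f i x * ∑ i, Du i x ^ 2) (volume.restrict Ω) :=
    (integrable_finsetSum _ fun j _ => (hDu2 j).integrable_sq).bdd_mul
      (hfs i).continuous.aestronglyMeasurable (Eventually.of_forall (hf1 i))
  rw [Finset.sum_add_distrib, ← Finset.mul_sum, ← Finset.sum_mul,
    ← integral_finsetSum _ fun i _ => i1 i, ← integral_finsetSum _ fun i _ => i2 i] at h
  refine le_trans (le_of_eq ?_) h
  congr 1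
  · refine setIntegral_congr_fun hΩ.isOpen.measurableSet fun x hx => ?_
    simp only
    rw [← Finset.sum_mul, ← Finset.sum_mul, hsum x hx]
  · congr 1
    refine setIntegral_congr_fun hΩ.isOpen.measurableSet fun x hx => ?_
    simp only
    rw [← Finset.sum_mul, hsum x hx]

/-- Young's inequality by completing the square, with gradient weight exactly `lam` so that it
cancels against the energy. -/
theorem mul_mul_le_add_div {D lam x y : ℝ} (hlam : 0 < lam) :
    D * (x * y) ≤ lam * x ^ 2 + D ^ 2 / (4 * lam) * y ^ 2 := by
  have h : lam * x ^ 2 + D ^ 2 / (4 * lam) * y ^ 2 - D * (x * y) =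
      (2 * lam * x - D * y) ^ 2 / (4 * lam) := by
    field_simp
    ring
  have : 0 ≤ (2 * lam * x - D * y) ^ 2 / (4 * lam) := by positivity
  linarith

end

theorem lemma5p1 (n : ℕ) (hn : 1 ≤ n) (Ω : Set (EuclideanSpace ℝ (Fin n)))
    (hΩ : IsSmoothBoundedDomain Ω)
    (Ka Kb Kc Kβ Kl : ℝ≥0) (lam chi : ℝ) (hlam : 0 < lam) (hchi : 0 < chi) :
    ∃ μstar : ℝ,
      ∀ (a : Fin n → Fin n → EuclideanSpace ℝ (Fin n) → ℝ)
        (b : Fin n → EuclideanSpace ℝ (Fin n) → ℝ)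
        (c : EuclideanSpace ℝ (Fin n) → ℝ)
        (β : Fin n → EuclideanSpace ℝ (Fin n) → ℝ)
        (l : EuclideanSpace ℝ (Fin n) → ℝ),
        (∀ i j, W1InftyBound Ω (a i j) Ka) →
        (∀ i, LInftyBound (volume.restrict Ω) (b i) Kb) →
        MemLp c ∞ (volume.restrict Ω) →
        eLpNorm (fun x => max (c x) 0) ∞ (volume.restrict Ω) ≤ Kc →
        (∀ i, W1InftyBoundaryBound Ω (β i) Kβ) →
        MemLp l ∞ (surfaceMeasure Ω) →
        eLpNorm (fun x => max (-l x) 0) ∞ (surfaceMeasure Ω) ≤ Kl →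
        (∀ᵐ x ∂(volume.restrict Ω), ∀ ξ : EuclideanSpace ℝ (Fin n),
          lam * ‖ξ‖ ^ 2 ≤ ∑ i, ∑ j, a i j x * ξ i * ξ j) →
        (∀ x ∈ frontier Ω, ∀ ν : EuclideanSpace ℝ (Fin n), IsOuterUnitNormal Ω x ν →
          chi ≤ ∑ i, β i x * ν i) →
        ∀ μ : ℝ, μstar < μ → ∀ u : EuclideanSpace ℝ (Fin n) → ℝ,
          IsH2Solution Ω a b c β l μ u → u =ᵐ[volume.restrict Ω] 0 := by
  obtain ⟨C, hC0, hC⟩ := hΩ.hasEnergyEstimate hn Ka Kβ Kl hlam hchi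
  -- These are the coefficients of the integral of `u²`: from the energy estimate, from `c⁺`, and
  -- from Young's inequality in each of the `n` components.
  refine ⟨C + Kc + n * ((C + Kb) ^ 2 / (4 * lam)),
    fun a b c β l ha hb _ hc hβ _ hl hell hobl μ hμ u hsol => ?_⟩
  obtain ⟨Du, D2u, u₀, Du₀, hH2, htr, htrD, heq, hbc⟩ := hsol
  have hu : IsH2WithTraces Ω u Du D2u u₀ Du₀ := ⟨hH2, htr, htrD⟩
  have had : IsAdmissible Ω Ka Kβ Kl lam chi a β l := by
    refine ⟨ha, hβ, ?_, hell, hobl⟩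
    filter_upwards [ae_abs_le_of_eLpNorm_top_le hl] with x hx
    exact (le_max_left _ _).trans ((le_abs_self _).trans hx)
  have hest := hC a β l had u Du D2u u₀ Du₀ hu hbc
  simp only [one_mul] at hest
  have hu2 := htr.1.memLp
  have hDu2 (i) := htr.1.memLp_deriv i
  have i1 : Integrable (fun x => (∑ i, ∑ j, a i j x * D2u i j x) * u x) (volume.restrict Ω) := by
    simpa only [one_mul] using integrable_sum_mul_mul (m := volume.restrict Ω)
      (ζ := fun _ => 1) (Z := 1) aestronglyMeasurable_const (by simp)
      (fun i j => (ha i j).1) (fun i j => (htrD i).1.memLp_deriv j) hu2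
  have i2 : Integrable (fun x => (∑ i, |Du i x|) * |u x|) (volume.restrict Ω) := by
    simp_rw [Finset.sum_mul]
    exact integrable_finsetSum _ fun i _ => ((hDu2 i).abs).integrable_mul hu2.abs
  have i3 : Integrable (fun x => u x ^ 2) (volume.restrict Ω) := hu2.integrable_sq
  have i4 : Integrable (fun x => ∑ i, Du i x ^ 2) (volume.restrict Ω) :=
    integrable_finsetSum _ fun i _ => (hDu2 i).integrable_sq
  have hlow : (μ - Kc) * (∫ x in Ω, u x ^ 2) - Kb * (∫ x in Ω, (∑ i, |Du i x|) * |u x|) ≤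
      ∫ x in Ω, (∑ i, ∑ j, a i j x * D2u i j x) * u x := by
    rw [← integral_const_mul, ← integral_const_mul,
      ← integral_sub (i3.const_mul _) (i2.const_mul _)]
    refine integral_mono_ae ((i3.const_mul _).sub (i2.const_mul _)) i1 ?_
    have hbK : ∀ᵐ x ∂(volume.restrict Ω), ∀ i, |b i x| ≤ Kb :=
      ae_all_iff.2 fun i => (hb i).ae_abs_le
    filter_upwards [heq, hbK, ae_abs_le_of_eLpNorm_top_le hc] with x hx hbx hcx
    have e1 : ∑ i, ∑ j, a i j x * D2u i j x = μ * u x - ∑ i, b i x * Du i x - c x * u x := by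
      linarith
    -- An upper bound for `c` suffices because it multiplies `u² ≥ 0`.
    have e2 : c x ≤ Kc := (le_max_left _ _).trans ((le_abs_self _).trans hcx)
    have e3 : (∑ i, b i x * Du i x) * u x ≤ Kb * ((∑ i, |Du i x|) * |u x|) := by
      refine (le_abs_self _).trans ?_
      rw [abs_mul, ← mul_assoc, Finset.mul_sum]
      refine mul_le_mul_of_nonneg_right ?_ (abs_nonneg _)
      refine (Finset.abs_sum_le_sum_abs _ _).trans (Finset.sum_le_sum fun i _ => ?_)
      rw [abs_mul]
      exact mul_le_mul_of_nonneg_right (hbx i) (abs_nonneg _)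
    have e4 := mul_le_mul_of_nonneg_right e2 (sq_nonneg (u x))
    rw [e1, sub_mul, sub_mul, sub_mul]
    linarith
  have hyoung : (C + Kb) * (∫ x in Ω, (∑ i, |Du i x|) * |u x|) ≤
      lam * (∫ x in Ω, ∑ i, Du i x ^ 2) +
        n * ((C + Kb) ^ 2 / (4 * lam)) * ∫ x in Ω, u x ^ 2 := by
    rw [← integral_const_mul, ← integral_const_mul, ← integral_const_mul,
      ← integral_add (i4.const_mul _) (i3.const_mul _)]
    refine integral_mono (i2.const_mul _) ((i4.const_mul _).add (i3.const_mul _)) fun x => ?_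
    have := Finset.sum_le_sum fun i (_ : i ∈ Finset.univ) =>
      mul_mul_le_add_div (D := C + Kb) (x := |Du i x|) (y := |u x|) hlam
    simp only [sq_abs, Finset.sum_add_distrib, ← Finset.mul_sum, ← Finset.sum_mul,
      Finset.sum_const, Finset.card_univ, Fintype.card_fin, nsmul_eq_mul, ← mul_assoc] at this ⊢
    linarith
  have hR0 : 0 ≤ ∫ x in Ω, u x ^ 2 := integral_nonneg fun x => sq_nonneg _
  have hR : ∫ x in Ω, u x ^ 2 = 0 := by
    by_contra hne
    have hpos : 0 < ∫ x in Ω, u x ^ 2 := lt_of_le_of_ne hR0 (Ne.symm hne)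
    have := mul_pos (sub_pos.2 hμ) hpos
    -- The gradient terms cancel, so `μ` minus the threshold times the integral of `u²` is at most
    -- zero.
    linarith
  have hz := (integral_eq_zero_iff_of_nonneg (fun x => sq_nonneg (u x)) i3).1 hR
  filter_upwards [hz] with x hx
  exact pow_eq_zero_iff two_ne_zero |>.1 hx
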